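/- Let $(V,g)$ be a finite-dimensional real vector space with a positive definite metric, $\dim V\ge 4$, and let $\mathcal T=\{K\in \mathrm{End}\,V \mid K^2=-1,\ g(K\cdot,K\cdot)=g(\cdot,\cdot)\}$ be its twistor space, regarded as a submanifold of $\mathrm{End}\,V$, so that $T_K\mathcal T=\{A\in\mathfrak o(V,g)\mid AK+KA=0\}$. Write $\mathfrak{gl}(\mathbb V)=\mathrm{End}\,V\times\mathcal T$ and $\mathfrak o(\mathbb V,g)=\mathfrak o(V,g)\times\mathcal T$ for the trivial bundles, $\phi$ for the section of $\mathfrak o(\mathbb V,g)$ with $\phi|_K=K$, $\Gamma$ for smooth sections, and $d$ for the trivial derivative of $\mathrm{End}\,V$-valued maps on $\mathcal T$. A skew algebroid $(E,[\cdot,\cdot],\psi)$ on $\mathcal T$ is a smooth vector bundle $E\to\mathcal T$ with a skew-symmetric $\mathbb R$-bilinear bracket on $\Gamma(E)$ and a smooth bundle map $\psi:E\to T\mathcal T$ such that $\psi([A,B])=[\psi(A),\psi(B)]_{Lie}$ and $[A,fB]=f[A,B]+\psi(A)[f]\,B$ for all $A,B\in\Gamma(E)$, $f\in C^\infty(\mathcal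 T)$. Fix $J\in\mathcal T$ and let $S\in\{\mathbb 1,\ J+\phi,\ J-\phi,\ [J,\phi]\}$. For $\gamma\in\{\pm J,\pm\phi\}$ let $\tilde\gamma$ be the unique element of $\{\pm J,\pm\phi\}$ with $\gamma S=S\tilde\gamma$; it is also the unique one with $S\gamma=\tilde\gamma S$. Let $E$ be one of $$\mathfrak o(\mathbb V,g),\quad \mathfrak o_{\{\phi\}}(\mathbb V)=\{A\in\mathfrak o(\mathbb V,g)\mid \phi A=-A\phi\},\quad \mathfrak u(\mathbb V,J)=\{A\in\mathfrak o(\mathbb V,g)\mid JA=AJ\},\quad \mathfrak u(\mathbb V,\phi)=\{A\in\mathfrak o(\mathbb V,g)\mid \phi A=A\phi\}.$$ If $E=\{A\in\mathfrak o(\mathbb V,g)\mid\gamma A=A\delta\}$ with $\gamma,\delta\in\{\pm J,\pm\phi\}$ as displayed, put $E^S=\{B\in\mathfrak o(\mathbb V,g)\mid\tilde\gamma B=B\tilde\delta\}$; if $E=\mathfrak o(\mathbb V,g)$, put $E^S=\mathfrak o(\mathbb V,g)$. Let $Q\in\Gamma(\mathfrak{gl}(\mathbb V))$ satisfy $Q^*=Q$,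 $[Q,J]=0$ and $[Q,\phi]=0$, let $F=QS$, and suppose that $$dQ_{[FCF,\phi]}=Q\,\bigl(dQ_{[SCS,\phi]}\bigr)\,Q\qquad\text{for all } C\in\Gamma(E^S).$$ Then, with $\psi:E^S\to T\mathcal T$, $\psi(A)=[FAF,\phi]$, there exists a skew bracket $[\cdot,\cdot]_F$ on $\Gamma(E^S)$ such that $(E^S,[\cdot,\cdot]_F,\psi)$ is a skew algebroid on $\mathcal T$. -/

import Mathlib

open scoped ContDiff InnerProductSpace

namespace Twistor

/-- A complex structure on the Euclidean space `V` compatible with its inner product. -/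
def IsCompatible {V : Type*} [NormedAddCommGroup V] [InnerProductSpace ℝ V]
    (K : V →L[ℝ] V) : Prop :=
  K * K = -1 ∧ ∀ x y : V, ⟪K x, K y⟫_ℝ = ⟪x, y⟫_ℝ

/-- The twistor space `𝒯(V)`, as a subset of the normed space `End V`. -/
def twistorSet (V : Type*) [NormedAddCommGroup V] [InnerProductSpace ℝ V] :
    Set (V →L[ℝ] V) :=
  {K | IsCompatible K}

/-- The twistor space `𝒯(V)`, as a type. -/
abbrev TwistorSpace (V : Type*) [NormedAddCommGroup V] [InnerProductSpace ℝ V] : Type _ :=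
  twistorSet V

section Calculus

variable {V : Type*} [NormedAddCommGroup V] [InnerProductSpace ℝ V]
variable {W : Type*} [NormedAddCommGroup W] [NormedSpace ℝ W]

/-- Smoothness near `K` of a map defined on the submanifold `𝒯(V) ⊆ End V`: near `K` it is the
restriction of a smooth map defined on an open subset of `End V`. -/
def SmoothAt (f : TwistorSpace V → W) (K : TwistorSpace V) : Prop :=
  ∃ (U : Set (V →L[ℝ] V)) (F : (V →L[ℝ] V) → W), IsOpen U ∧ (K : V →L[ℝ] V) ∈ U ∧
    ContDiffOn ℝ ∞ F U ∧ ∀ L : TwistorSpace V, (L : V →L[ℝ] V) ∈ U → F L = f L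

/-- Smooth maps on `𝒯(V)`. -/
def Smooth (f : TwistorSpace V → W) : Prop := ∀ K, SmoothAt f K

theorem SmoothAt.add {f g : TwistorSpace V → W} {K : TwistorSpace V}
    (hf : SmoothAt f K) (hg : SmoothAt g K) : SmoothAt (f + g) K := by
  obtain ⟨U, F, hU, hK, hF, h⟩ := hf
  obtain ⟨U', G, hU', hK', hG, h'⟩ := hg
  refine ⟨U ∩ U', F + G, hU.inter hU', ⟨hK, hK'⟩,
    (hF.mono Set.inter_subset_left).add (hG.mono Set.inter_subset_right), fun L hL => ?_⟩
  simp [h L hL.1, h' L hL.2]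

theorem SmoothAt.smul {f : TwistorSpace V → ℝ} {g : TwistorSpace V → W} {K : TwistorSpace V}
    (hf : SmoothAt f K) (hg : SmoothAt g K) : SmoothAt (fun L => f L • g L) K := by
  obtain ⟨U, F, hU, hK, hF, h⟩ := hf
  obtain ⟨U', G, hU', hK', hG, h'⟩ := hg
  refine ⟨U ∩ U', fun x => F x • G x, hU.inter hU', ⟨hK, hK'⟩,
    (hF.mono Set.inter_subset_left).smul (hG.mono Set.inter_subset_right), fun L hL => ?_⟩
  simp [h L hL.1, h' L hL.2]

theorem Smooth.const (w : W) : Smooth (fun _ : TwistorSpace V => w) := fun _ =>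
  ⟨Set.univ, fun _ => w, isOpen_univ, trivial, contDiffOn_const, fun _ _ => rfl⟩

/-- The derivative `df_X` at `K` of a map `f` on `𝒯(V)` along a vector `X` tangent to `𝒯(V)` at `K`.
For smooth `f` and tangent `X` it is the derivative of `f` along any curve in `𝒯(V)` through `K`
with velocity `X`, see `hasDerivAt_comp_curve` and `mem_tangent_iff` below. -/
noncomputable def tderiv (f : TwistorSpace V → W) (K : TwistorSpace V) (X : V →L[ℝ] V) : W :=
  fderivWithin ℝ (Function.extend Subtype.val f 0) (twistorSet V) K X

/-- The Lie bracket of vector fields on the submanifold `𝒯(V) ⊆ End V`; vector fields are regarded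
as `End V`-valued maps, and `[X, Y] = dY_X - dX_Y`. -/
noncomputable def lieBracket (X Y : TwistorSpace V → (V →L[ℝ] V)) (K : TwistorSpace V) :
    V →L[ℝ] V :=
  tderiv Y K (X K) - tderiv X K (Y K)

end Calculus

section Bundles

variable (V : Type*) [NormedAddCommGroup V] [InnerProductSpace ℝ V]

/-- `𝔬(V, g)`: the skew-adjoint endomorphisms. -/
def skew : Submodule ℝ (V →L[ℝ] V) where
  carrier := {A | ∀ x y : V, ⟪A x, y⟫_ℝ = -⟪x, A y⟫_ℝ}
  add_mem' {A B} hA hB x y := by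
    have h1 := hA x y
    have h2 := hB x y
    simp only [add_apply, inner_add_left, inner_add_right, h1, h2]
    ring
  zero_mem' x y := by simp
  smul_mem' c A hA x y := by
    have h1 := hA x y
    simp only [smul_apply, real_inner_smul_left, real_inner_smul_right, h1]
    ring

variable {V}

/-- The endomorphisms `A ∈ 𝔬(V, g)` with `P A = A R`. -/
def skewRel (P R : V →L[ℝ] V) : Submodule ℝ (V →L[ℝ] V) where
  carrier := {A | A ∈ skew V ∧ P * A = A * R}
  add_mem' {A B} hA hB := ⟨add_mem hA.1 hB.1, by rw [mul_add, add_mul, hA.2, hB.2]⟩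
  zero_mem' := ⟨zero_mem _, by simp⟩
  smul_mem' c A hA := ⟨Submodule.smul_mem _ c hA.1, by rw [mul_smul_comm, smul_mul_assoc, hA.2]⟩

/-- The tangent space `T_K 𝒯 = {A ∈ 𝔬(V, g) | {A, K} = 0}`, a subspace of `End V`; it consists of
the velocities of curves in `𝒯(V)` through `K`, see `mem_tangent_iff` below. -/
def tangent (K : TwistorSpace V) : Submodule ℝ (V →L[ℝ] V) :=
  skewRel (K : V →L[ℝ] V) (-K)

/-- A family of subspaces of `End V` over `𝒯(V)` is a smooth vector subbundle of
`𝔤𝔩(𝕍) = End V × 𝒯(V)`: it admits smooth local frames. -/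
def IsSubbundle (E : TwistorSpace V → Submodule ℝ (V →L[ℝ] V)) : Prop :=
  ∀ K, ∃ (U : Set (TwistorSpace V)) (r : ℕ) (e : Fin r → TwistorSpace V → (V →L[ℝ] V)),
    IsOpen U ∧ K ∈ U ∧ (∀ i, ∀ L ∈ U, SmoothAt (e i) L) ∧
    ∀ L ∈ U, LinearIndependent ℝ (fun i => e i L) ∧
      Submodule.span ℝ (Set.range fun i => e i L) = E L

/-- `Γ(E)`: the smooth sections of `E`. -/
def Sections (E : TwistorSpace V → Submodule ℝ (V →L[ℝ] V)) :
    Submodule ℝ (TwistorSpace V → (V →L[ℝ] V)) where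
  carrier := {A | Smooth A ∧ ∀ K, A K ∈ E K}
  add_mem' hA hB := ⟨fun K => (hA.1 K).add (hB.1 K), fun K => add_mem (hA.2 K) (hB.2 K)⟩
  zero_mem' := ⟨Smooth.const 0, fun _ => zero_mem _⟩
  smul_mem' c _ hA := ⟨fun K => (Smooth.const c K).smul (hA.1 K),
    fun K => Submodule.smul_mem _ c (hA.2 K)⟩

/-- The value `A|_K ∈ E_K` of a section. -/
def valueAt {E : TwistorSpace V → Submodule ℝ (V →L[ℝ] V)} (A : Sections E)
    (K : TwistorSpace V) : E K :=
  ⟨A.1 K, A.2.2 K⟩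

/-- The section `f A` for a smooth function `f` on `𝒯(V)`. -/
def fsmul {E : TwistorSpace V → Submodule ℝ (V →L[ℝ] V)} (f : TwistorSpace V → ℝ)
    (hf : Smooth f) (A : Sections E) : Sections E :=
  ⟨fun K => f K • A.1 K, fun K => (hf K).smul (A.2.1 K),
    fun K => Submodule.smul_mem _ (f K) (A.2.2 K)⟩

/-- The `End V`-valued map `K ↦ ψ_K(A|_K)`. -/
def applyAnchor {E : TwistorSpace V → Submodule ℝ (V →L[ℝ] V)}
    (ψ : ∀ K, E K →ₗ[ℝ] (V →L[ℝ] V)) (A : Sections E) : TwistorSpace V → (V →L[ℝ] V) :=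
  fun K => ψ K (valueAt A K)

/-- `(E, [·,·], ψ)` is a skew algebroid on `𝒯(V)`: `E` is a vector bundle, `ψ : E → T𝒯` is a smooth
bundle map, and the skew-symmetric `ℝ`-bilinear bracket on `Γ(E)` satisfies
`ψ([A, B]) = [ψ(A), ψ(B)]_Lie` and `[A, f B] = f [A, B] + ψ(A)[f] B`. -/
structure IsSkewAlgebroid (E : TwistorSpace V → Submodule ℝ (V →L[ℝ] V))
    (br : Sections E →ₗ[ℝ] Sections E →ₗ[ℝ] Sections E)
    (ψ : ∀ K, E K →ₗ[ℝ] (V →L[ℝ] V)) : Prop where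
  subbundle : IsSubbundle E
  anchor_tangent : ∀ K (a : E K), ψ K a ∈ tangent K
  anchor_smooth : ∀ A : Sections E, Smooth (applyAnchor ψ A)
  skew_symm : ∀ A B, br A B = -br B A
  anchor_bracket : ∀ A B K,
    applyAnchor ψ (br A B) K = lieBracket (applyAnchor ψ A) (applyAnchor ψ B) K
  leibniz : ∀ A B (f : TwistorSpace V → ℝ) (hf : Smooth f) K,
    (br A (fsmul f hf B)).1 K = f K • (br A B).1 K + tderiv f K (applyAnchor ψ A K) • B.1 K

/-- Names for the four sections `J, -J, φ, -φ` of `𝔬(𝕍, g)`. -/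
inductive Gen
  | J
  | negJ
  | phi
  | negPhi

/-- The section of `𝔬(𝕍, g)` named by an element of `{±J, ±φ}`; here `φ|_K = K`. -/
def Gen.eval (J : TwistorSpace V) : Gen → TwistorSpace V → (V →L[ℝ] V)
  | .J, _ => J
  | .negJ, _ => -J
  | .phi, K => K
  | .negPhi, K => -K

/-- Names for the four sections `1, J + φ, J - φ, [J, φ]` of `𝔤𝔩(𝕍)`. -/
inductive SType
  | one
  | plus
  | minus
  | comm

/-- The section of `𝔤𝔩(𝕍)` named by an element of `{1, J + φ, J - φ, [J, φ]}`. -/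
def SType.eval (J : TwistorSpace V) : SType → TwistorSpace V → (V →L[ℝ] V)
  | .one, _ => 1
  | .plus, K => J + K
  | .minus, K => J - K
  | .comm, K => J * K - K * J

/-- The element `γ̃ ∈ {±J, ±φ}` with `γ S = S γ̃`, equivalently `S γ = γ̃ S`; see `eval_mul_eval`,
`eval_mul_eval'` for these identities and `eq_tilde`, `eq_tilde'` for the uniqueness. -/
def SType.tilde : SType → Gen → Gen
  | .one, γ => γ
  | .plus, .J => .phi
  | .plus, .negJ => .negPhi
  | .plus, .phi => .J
  | .plus, .negPhi => .negJ
  | .minus, .J => .negPhi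
  | .minus, .negJ => .phi
  | .minus, .phi => .negJ
  | .minus, .negPhi => .J
  | .comm, .J => .negJ
  | .comm, .negJ => .J
  | .comm, .phi => .negPhi
  | .comm, .negPhi => .phi

/-- The bundles `𝔬(𝕍, g)` (`all`) and `{A ∈ 𝔬(𝕍, g) | γ A = A δ}` (`rel γ δ`). -/
inductive BType
  | all
  | rel (γ δ : Gen)

/-- The fibres of the bundle named by an element of `BType`. -/
def BType.fiber (J : TwistorSpace V) : BType → TwistorSpace V → Submodule ℝ (V →L[ℝ] V)
  | .all, _ => skew V
  | .rel γ δ, K => skewRel (γ.eval J K) (δ.eval J K)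

/-- `𝔲(𝕍, J) = {A | [A, J] = 0}`. -/
def BType.uJ : BType := .rel .J .J

/-- `𝔲(𝕍, φ) = {A | [A, φ] = 0}`. -/
def BType.uPhi : BType := .rel .phi .phi

/-- `𝔬_{φ}(𝕍) = {A | {A, φ} = 0}`. -/
def BType.oPhi : BType := .rel .phi .negPhi

/-- The bundle `E^S`: `{B | γ̃ B = B δ̃}` if `E = {A | γ A = A δ}`, and `𝔬(𝕍, g)^S = 𝔬(𝕍, g)`. -/
def BType.twist (S : SType) : BType → BType
  | .all => .all
  | .rel γ δ => .rel (S.tilde γ) (S.tilde δ)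

/-- The linear map `A ↦ [F A F, K]` on a subspace of `End V`. -/
def anchor (E : TwistorSpace V → Submodule ℝ (V →L[ℝ] V))
    (F : TwistorSpace V → (V →L[ℝ] V)) (K : TwistorSpace V) : E K →ₗ[ℝ] (V →L[ℝ] V) where
  toFun A := F K * A * F K * K - K * (F K * A * F K)
  map_add' A B := by
    simp only [Submodule.coe_add, mul_add, add_mul]
    abel
  map_smul' c A := by
    simp only [Submodule.coe_smul, mul_smul_comm, smul_mul_assoc, RingHom.id_apply, smul_sub]

end Bundles

section WellDefined

variable {V : Type*} [NormedAddCommGroup V] [InnerProductSpace ℝ V]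
variable {W : Type*} [NormedAddCommGroup W] [NormedSpace ℝ W]

theorem hasFDerivWithinAt_extend {f : TwistorSpace V → W} {K : TwistorSpace V}
    {U : Set (V →L[ℝ] V)} {F : (V →L[ℝ] V) → W} (hU : IsOpen U) (hK : (K : V →L[ℝ] V) ∈ U)
    (hF : ContDiffOn ℝ ∞ F U)
    (h : ∀ L : TwistorSpace V, (L : V →L[ℝ] V) ∈ U → F L = f L) :
    HasFDerivWithinAt (Function.extend Subtype.val f 0) (fderiv ℝ F K) (twistorSet V)
      (K : V →L[ℝ] V) := by
  have h1 : HasFDerivAt F (fderiv ℝ F K) (K : V →L[ℝ] V) :=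
    ((hF.contDiffAt (hU.mem_nhds hK)).differentiableAt (by simp)).hasFDerivAt
  have h2 : ∀ L : TwistorSpace V, (L : V →L[ℝ] V) ∈ U →
      Function.extend Subtype.val f 0 (L : V →L[ℝ] V) = F L := fun L hL => by
    rw [Subtype.val_injective.extend_apply, h L hL]
  refine h1.hasFDerivWithinAt.congr_of_eventuallyEq ?_ (h2 K hK)
  filter_upwards [self_mem_nhdsWithin, mem_nhdsWithin_of_mem_nhds (hU.mem_nhds hK)] with x hx hxU
  exact h2 ⟨x, hx⟩ hxU

/-- `df_X` is the derivative of `f` along every curve in `𝒯(V)` with velocity `X`. -/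
theorem hasDerivAt_comp_curve {f : TwistorSpace V → W} {c : ℝ → TwistorSpace V}
    {X : V →L[ℝ] V} (hf : SmoothAt f (c 0))
    (hc : HasDerivAt (fun t => (c t : V →L[ℝ] V)) X 0) :
    HasDerivAt (fun t => f (c t)) (tderiv f (c 0) X) 0 := by
  obtain ⟨U, F, hU, hK, hF, h⟩ := hf
  have h1 := (hasFDerivWithinAt_extend hU hK hF h).differentiableWithinAt.hasFDerivWithinAt
  have h2 := h1.comp_hasDerivAt (f := fun t => (c t : V →L[ℝ] V)) (0 : ℝ) hc
    (Filter.Eventually.of_forall fun t => (c t).2)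
  refine h2.congr_of_eventuallyEq (Filter.Eventually.of_forall fun t => ?_)
  simp

theorem coe_mul_self (K : TwistorSpace V) : (K : V →L[ℝ] V) * K = -1 := K.2.1

theorem apply_apply (K : TwistorSpace V) (x : V) : (K : V →L[ℝ] V) ((K : V →L[ℝ] V) x) = -x := by
  have := congrArg (fun A : V →L[ℝ] V => A x) (coe_mul_self K)
  simpa using this

theorem coe_mem_skew (K : TwistorSpace V) : (K : V →L[ℝ] V) ∈ skew V := fun x y => by
  have := K.2.2 x ((K : V →L[ℝ] V) y)
  rw [apply_apply, inner_neg_right] at this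
  linarith

/-- The tangent vectors at `K` are the velocities of curves in `𝒯(V)` through `K`. -/
theorem mem_tangent_iff [FiniteDimensional ℝ V] (K : TwistorSpace V) (X : V →L[ℝ] V) :
    X ∈ tangent K ↔ ∃ c : ℝ → TwistorSpace V, c 0 = K ∧
      HasDerivAt (fun t => (c t : V →L[ℝ] V)) X 0 := by
  have : CompleteSpace V := FiniteDimensional.complete ℝ V
  let : NormedAlgebra ℚ (V →L[ℝ] V) := NormedAlgebra.restrictScalars ℚ ℝ (V →L[ℝ] V)
  constructor
  · rintro ⟨hX, hXK⟩
    set k : V →L[ℝ] V := (K : V →L[ℝ] V) with hk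
    have hkk : k * k = -1 := coe_mul_self K
    have hXK' : k * X = -(X * k) := by rw [hXK]; simp
    obtain ⟨Z, hZ⟩ : ∃ Z : V →L[ℝ] V, Z = -(X * k) := ⟨_, rfl⟩
    have hZs : ∀ x y : V, ⟪Z x, y⟫_ℝ = -⟪x, Z y⟫_ℝ := fun x y => by
      have e1 : Z y = k (X y) := by rw [hZ, ← hXK']; rfl
      have e2 : Z x = -(X (k x)) := by rw [hZ]; rfl
      rw [e1, e2, inner_neg_left, hX, ← neg_neg (⟪k x, X y⟫_ℝ), show ⟪k x, X y⟫_ℝ = -⟪x, k (X y)⟫_ℝ from coe_mem_skew K x (X y)]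
      simp
    have hZk : Z * k = -(k * Z) := by
      have e1 : Z * k = X := by rw [hZ, neg_mul, mul_assoc, hkk]; simp
      have e2 : k * Z = -X := by rw [hZ, ← hXK', ← mul_assoc, hkk]; simp
      rw [e1, e2, neg_neg]
    have hZsk : Z ∈ skewAdjoint (V →L[ℝ] V) := by
      rw [skewAdjoint.mem_iff]
      refine ContinuousLinearMap.ext fun x => ext_inner_right ℝ fun y => ?_
      rw [ContinuousLinearMap.star_eq_adjoint, ContinuousLinearMap.adjoint_inner_left,
        neg_apply, inner_neg_left, hZs x y, neg_neg]
    have hcomm : ∀ t : ℝ, k * NormedSpace.exp (t • Z) = NormedSpace.exp (-(t • Z)) * k := by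
      intro t
      have : SemiconjBy k (t • Z) (-(t • Z)) := by
        unfold SemiconjBy
        rw [mul_smul_comm, neg_mul, smul_mul_assoc, hZk, smul_neg, neg_neg]
      exact this.exp_right
    have hu : ∀ t : ℝ, NormedSpace.exp (t • Z) ∈ unitary (V →L[ℝ] V) := fun t =>
      NormedSpace.exp_mem_unitary_of_mem_skewAdjoint (skewAdjoint.smul_mem t hZsk)
    have hexp : ∀ t : ℝ, NormedSpace.exp (t • Z) * NormedSpace.exp (-(t • Z)) = 1 := fun t => by
      rw [← NormedSpace.exp_add_of_commute (Commute.neg_right (Commute.refl _))]; simp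
    refine ⟨fun t => ⟨NormedSpace.exp (t • Z) * k, ?_, ?_⟩, ?_, ?_⟩
    · rw [mul_assoc, ← mul_assoc k, hcomm, mul_assoc (NormedSpace.exp (-(t • Z))), ← mul_assoc,
        hexp, one_mul, hkk]
    · intro x y
      have h1 := (Unitary.mem_iff.1 (hu t)).1
      rw [mul_apply_eq_comp, mul_apply_eq_comp,
        ← ContinuousLinearMap.adjoint_inner_right, ← ContinuousLinearMap.star_eq_adjoint,
        ← mul_apply_eq_comp, h1, one_apply_eq_self]
      exact K.2.2 x y
    · apply Subtype.ext; simp [hk]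
    · have h0 := (hasDerivAt_exp_smul_const (𝕂 := ℝ) Z (0 : ℝ)).mul_const k
      have : NormedSpace.exp ((0 : ℝ) • Z) * Z * k = X := by
        rw [zero_smul, NormedSpace.exp_zero, one_mul, hZ, neg_mul, mul_assoc, hkk]; simp
      rw [this] at h0
      exact h0
  · rintro ⟨c, rfl, hc⟩
    refine ⟨fun x y => ?_, ?_⟩
    · have h1 : HasDerivAt (fun t => ⟪(c t : V →L[ℝ] V) x, y⟫_ℝ) (⟪X x, y⟫_ℝ) 0 := by
        have := (hc.clm_apply (hasDerivAt_const (0 : ℝ) x)).inner ℝ (hasDerivAt_const (0 : ℝ) y)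
        simpa using this
      have h2 : HasDerivAt (fun t => -⟪x, (c t : V →L[ℝ] V) y⟫_ℝ) (-⟪x, X y⟫_ℝ) 0 := by
        have := ((hasDerivAt_const (0 : ℝ) x).inner ℝ
          (hc.clm_apply (hasDerivAt_const (0 : ℝ) y))).neg
        simp only [inner_zero_left, add_zero, map_zero] at this
        exact this
      have h3 : (fun t => ⟪(c t : V →L[ℝ] V) x, y⟫_ℝ) = fun t => -⟪x, (c t : V →L[ℝ] V) y⟫_ℝ :=
        funext fun t => coe_mem_skew (c t) x y
      rw [h3] at h1
      exact h1.unique h2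
    · have h1 := hc.mul hc
      have h2 : ((fun t => (c t : V →L[ℝ] V)) * fun t => (c t : V →L[ℝ] V)) = fun _ => -1 :=
        funext fun t => coe_mul_self (c t)
      rw [h2] at h1
      have := h1.unique (hasDerivAt_const (0 : ℝ) (-1 : V →L[ℝ] V))
      rw [mul_neg]
      exact eq_neg_of_add_eq_zero_right this

theorem eval_mul_eval (J K : TwistorSpace V) (S : SType) (γ : Gen) :
    γ.eval J K * S.eval J K = S.eval J K * (S.tilde γ).eval J K := by
  ext x
  cases S <;> cases γ <;>
    simp [Gen.eval, SType.eval, SType.tilde, apply_apply] <;> abel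

theorem eval_mul_eval' (J K : TwistorSpace V) (S : SType) (γ : Gen) :
    S.eval J K * γ.eval J K = (S.tilde γ).eval J K * S.eval J K := by
  ext x
  cases S <;> cases γ <;>
    simp [Gen.eval, SType.eval, SType.tilde, apply_apply] <;> abel

theorem exists_anticommuting [FiniteDimensional ℝ V] (hdim : 4 ≤ Module.finrank ℝ V)
    (J : TwistorSpace V) : ∃ (K : TwistorSpace V) (e : V), e ≠ 0 ∧
      (J : V →L[ℝ] V) ((K : V →L[ℝ] V) e) = -(K : V →L[ℝ] V) ((J : V →L[ℝ] V) e) := by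
  set j : V →L[ℝ] V := (J : V →L[ℝ] V) with hj
  have hsk : ∀ x y : V, ⟪j x, y⟫_ℝ = -⟪x, j y⟫_ℝ := coe_mem_skew J
  have hjx : ∀ x : V, ⟪j x, x⟫_ℝ = 0 := fun x => by
    have := hsk x x
    rw [real_inner_comm x (j x)] at this
    linarith [real_inner_comm x (j x)]
  have hnorm : ∀ x : V, ‖j x‖ = ‖x‖ := fun x => by
    have := J.2.2 x x
    rw [real_inner_self_eq_norm_sq, real_inner_self_eq_norm_sq] at this
    exact (sq_eq_sq₀ (norm_nonneg _) (norm_nonneg _)).1 this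
  have : Nontrivial V := Module.nontrivial_of_finrank_pos (R := ℝ) (by omega)
  obtain ⟨a, ha⟩ := exists_norm_eq V (zero_le_one' ℝ)
  have hspan : Module.finrank ℝ (Submodule.span ℝ (Set.range ![a, j a])) ≤ 2 := by
    have := finrank_range_le_card (R := ℝ) ![a, j a]
    rwa [Fintype.card_fin] at this
  have hperp := Submodule.finrank_add_finrank_orthogonal
    (Submodule.span ℝ (Set.range ![a, j a]))
  have : Nontrivial (Submodule.span ℝ (Set.range ![a, j a]))ᗮ :=
    Module.nontrivial_of_finrank_pos (R := ℝ) (by omega)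
  obtain ⟨b', hb'⟩ :=
    exists_norm_eq (Submodule.span ℝ (Set.range ![a, j a]))ᗮ (zero_le_one' ℝ)
  obtain ⟨b, hb⟩ := b'
  have hb1 : ‖b‖ = 1 := hb'
  have hab : ⟪a, b⟫_ℝ = 0 := Submodule.mem_orthogonal _ _ |>.1 hb a
    (Submodule.subset_span ⟨0, rfl⟩)
  have hjab : ⟪j a, b⟫_ℝ = 0 := Submodule.mem_orthogonal _ _ |>.1 hb (j a)
    (Submodule.subset_span ⟨1, rfl⟩)
  have hfix : ∀ v x : V, ⟪v, x⟫_ℝ = 0 → (Submodule.span ℝ {v})ᗮ.reflection x = x :=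
    fun v x h => Submodule.reflection_mem_subspace_eq_self
      (Submodule.mem_orthogonal_singleton_iff_inner_right.2 h)
  set R₁ := (Submodule.span ℝ {j a - b})ᗮ.reflection with hR₁
  set R₂ := (Submodule.span ℝ {b})ᗮ.reflection with hR₂
  have r1 : R₁ (j a) = b := Submodule.reflection_sub (by rw [hnorm, ha, hb1])
  have r1' : R₁ b = j a := by rw [← r1, hR₁, Submodule.reflection_reflection]
  have r2 : R₁ a = a := hfix _ _ (by rw [inner_sub_left, hjx, real_inner_comm, hab, sub_zero])
  have r3 : R₁ (j b) = j b := hfix _ _ (by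
    have : ⟪b, j b⟫_ℝ = 0 := by rw [real_inner_comm, hjx]
    rw [inner_sub_left, J.2.2, hab, this, sub_zero])
  have s1 : R₂ b = -b := Submodule.reflection_orthogonalComplement_singleton_eq_neg b
  have s2 : R₂ a = a := hfix _ _ (by rw [real_inner_comm, hab])
  have s3 : R₂ (j a) = j a := hfix _ _ (by rw [real_inner_comm, hjab])
  have s4 : R₂ (j b) = j b := hfix _ _ (by rw [real_inner_comm, hjx])
  let k : V →L[ℝ] V := (R₁ : V →L[ℝ] V) * (R₂ : V →L[ℝ] V) * j * (R₂ : V →L[ℝ] V) *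
    (R₁ : V →L[ℝ] V)
  have hkx : ∀ x, k x = R₁ (R₂ (j (R₂ (R₁ x)))) := fun x => rfl
  have hk : IsCompatible k := by
    refine ⟨?_, fun x y => ?_⟩
    · ext x
      rw [mul_apply_eq_comp, hkx, hkx, hR₁, hR₂]
      simp only [Submodule.reflection_reflection]
      rw [hj, apply_apply]
      simp [Submodule.reflection_reflection]
    · rw [hkx, hkx, LinearIsometryEquiv.inner_map_map, LinearIsometryEquiv.inner_map_map, J.2.2,
        LinearIsometryEquiv.inner_map_map, LinearIsometryEquiv.inner_map_map]
  refine ⟨⟨k, hk⟩, a, fun h => by simp [h] at ha, ?_⟩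
  change j (k a) = -k (j a)
  rw [hkx, hkx, r2, s2, s3, r1, s1, map_neg, map_neg, map_neg, s4, r3, neg_neg]

/-- On vectors where `J` and `K` anticommute, every `S` is injective. -/
theorem SType.eq_zero_of_eval {J K : TwistorSpace V} {w : V}
    (hw : (J : V →L[ℝ] V) ((K : V →L[ℝ] V) w) = -(K : V →L[ℝ] V) ((J : V →L[ℝ] V) w))
    (S : SType) (h : S.eval J K w = 0) : w = 0 := by
  have h2 := congrArg (S.eval J K) h
  cases S
  · simpa [SType.eval] using h
  · simp only [SType.eval, add_apply, map_add, apply_apply, hw, map_zero] at h2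
    have : (2 : ℝ) • w = 0 := by rw [two_smul, ← neg_eq_zero, ← h2]; abel
    simpa using this
  · simp only [SType.eval, sub_apply, map_sub, apply_apply, hw, map_zero] at h2
    have : (2 : ℝ) • w = 0 := by rw [two_smul, ← neg_eq_zero, ← h2]; abel
    simpa using this
  · simp only [SType.eval, sub_apply, mul_apply_eq_comp, hw] at h
    have h3 : (2 : ℝ) • (K : V →L[ℝ] V) ((J : V →L[ℝ] V) w) = 0 := by
      rw [two_smul, ← neg_eq_zero, ← h]; abel
    have h4 : (K : V →L[ℝ] V) ((J : V →L[ℝ] V) w) = 0 := by simpa using h3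
    have h5 := congrArg (fun x => (J : V →L[ℝ] V) ((K : V →L[ℝ] V) x)) h4
    simpa [apply_apply] using h5

/-- On nonzero vectors where `J` and `K` anticommute, `J, -J, K, -K` are pairwise distinct. -/
theorem Gen.eq_of_eval {J K : TwistorSpace V} {w : V}
    (hw : (J : V →L[ℝ] V) ((K : V →L[ℝ] V) w) = -(K : V →L[ℝ] V) ((J : V →L[ℝ] V) w))
    (h0 : w ≠ 0) (γ γ' : Gen) (h : γ.eval J K w = γ'.eval J K w) : γ = γ' := by
  have key : ∀ u : V, (2 : ℝ) • u = 0 → u = 0 := fun u hu => by simpa using hu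
  have hJ : (J : V →L[ℝ] V) w ≠ 0 := fun h1 => h0 (by
    rw [← neg_eq_zero, ← apply_apply J w, h1, map_zero])
  have hK : (K : V →L[ℝ] V) w ≠ 0 := fun h1 => h0 (by
    rw [← neg_eq_zero, ← apply_apply K w, h1, map_zero])
  have hp : (J : V →L[ℝ] V) w + (K : V →L[ℝ] V) w ≠ 0 := fun h1 => h0 (by
    exact SType.eq_zero_of_eval hw .plus h1)
  have hm : (J : V →L[ℝ] V) w - (K : V →L[ℝ] V) w ≠ 0 := fun h1 => h0 (by
    exact SType.eq_zero_of_eval hw .minus h1)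
  cases γ <;> cases γ' <;> first
    | rfl
    | (exfalso
       simp only [Gen.eval, neg_apply] at h
       first
         | (apply hm; rw [h]; simp; done)
         | (apply hm; rw [← h]; simp; done)
         | (apply hp; rw [h]; simp; done)
         | (apply hp; rw [← h]; simp; done)
         | (apply hm; rw [neg_inj.1 h]; simp; done)
         | (apply hJ; apply key; rw [two_smul]; nth_rewrite 1 [h]; simp; done)
         | (apply hJ; apply key; rw [two_smul]; nth_rewrite 1 [← h]; simp; done)
         | (apply hK; apply key; rw [two_smul]; nth_rewrite 1 [h]; simp; done)
         | (apply hK; apply key; rw [two_smul]; nth_rewrite 1 [← h]; simp; done))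

/-- `γ̃` is the only element of `{±J, ±φ}` with `γ S = S γ̃` on `𝒯(V)`. -/
theorem eq_tilde [FiniteDimensional ℝ V] (hdim : 4 ≤ Module.finrank ℝ V) (J : TwistorSpace V)
    (S : SType) (γ γ' : Gen)
    (h : ∀ K, γ.eval J K * S.eval J K = S.eval J K * γ'.eval J K) : γ' = S.tilde γ := by
  obtain ⟨K, e, he, hJK⟩ := exists_anticommuting hdim J
  have h1 := h K
  rw [eval_mul_eval] at h1
  have h2 := congrArg (fun A : V →L[ℝ] V => A e) h1
  simp only [mul_apply_eq_comp] at h2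
  refine (Gen.eq_of_eval hJK he _ _ (sub_eq_zero.1 ?_)).symm
  refine SType.eq_zero_of_eval (J := J) (K := K) ?_ S (by rw [map_sub, h2, sub_self])
  have hJ : ∀ γ : Gen, (J : V →L[ℝ] V) ((K : V →L[ℝ] V) (γ.eval J K e)) =
      -(K : V →L[ℝ] V) ((J : V →L[ℝ] V) (γ.eval J K e)) := by
    have t1 : (K : V →L[ℝ] V) ((J : V →L[ℝ] V) e) = -(J : V →L[ℝ] V) ((K : V →L[ℝ] V) e) := by
      rw [hJK, neg_neg]
    have t2 : (K : V →L[ℝ] V) ((J : V →L[ℝ] V) ((K : V →L[ℝ] V) e)) = (J : V →L[ℝ] V) e := by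
      rw [hJK, map_neg, apply_apply, neg_neg]
    intro γ
    cases γ <;> simp [Gen.eval, apply_apply, t1, t2]
  rw [map_sub, map_sub, hJ, hJ, map_sub, map_sub]
  abel

/-- `γ̃` is the only element of `{±J, ±φ}` with `S γ = γ̃ S` on `𝒯(V)`. -/
theorem eq_tilde' [FiniteDimensional ℝ V] (hdim : 4 ≤ Module.finrank ℝ V) (J : TwistorSpace V)
    (S : SType) (γ γ' : Gen)
    (h : ∀ K, S.eval J K * γ.eval J K = γ'.eval J K * S.eval J K) : γ' = S.tilde γ := by
  obtain ⟨K, e, he, hJK⟩ := exists_anticommuting hdim J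
  have h1 := h K
  rw [eval_mul_eval'] at h1
  have h2 := congrArg (fun A : V →L[ℝ] V => A e) h1
  simp only [mul_apply_eq_comp] at h2
  refine (Gen.eq_of_eval (J := J) (K := K) (w := S.eval J K e) ?_
    (fun h0 => he (SType.eq_zero_of_eval hJK S h0)) _ _ h2).symm
  have t1 : (K : V →L[ℝ] V) ((J : V →L[ℝ] V) e) = -(J : V →L[ℝ] V) ((K : V →L[ℝ] V) e) := by
    rw [hJK, neg_neg]
  have t2 : (K : V →L[ℝ] V) ((J : V →L[ℝ] V) ((K : V →L[ℝ] V) e)) = (J : V →L[ℝ] V) e := by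
    rw [hJK, map_neg, apply_apply, neg_neg]
  cases S <;> simp [SType.eval, apply_apply, t1, t2] <;> abel

end WellDefined

end Twistor

/-! For smooth skew-valued `a`, `b`, the Leibniz rule and the Jacobi identity give
`[[a,φ],[b,φ]]_Lie = [c,φ]` with `c = db_{[a,φ]} - da_{[b,φ]} - [a,b]` (`lieBracket_commRight`). For
`a = FAF` and `b = FBF` the task is therefore to write `c` as `FCF` with `C` smooth. Since `F` may
be degenerate, `C` has to come from factoring, not from inverting `F`.

The factorization rests on `dF_{[FAF,φ]} = FΛ` with `Λ` explicit, smooth over the twistor space and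
linear in `A`; the hypothesis on `dQ` enters exactly here (`tderiv_eq_mul_leftFactor`). As `F` is
symmetric or skew, the same derivative equals `Λ*F`, so along `[FAF,φ]` the derivative of `FBF` is
`F(dB + ΛB + BΛ*)F`. Together with `FAF·FBF = F(A F² B)F` this gives `c = FCF`, where `C` is the
antisymmetrized `halfBracket` (`mul_halfBracket_sub_mul`). Since `halfBracket` is linear over
functions in `A` and a derivation in `B`, the Leibniz rule follows.

The endomorphism `C` is skew but need not lie in `E^S`, so it is projected there. Sandwiching by `F`
turns this projection into the one onto `E` (`IsTwisting.mul_proj_mul`), and for each of the four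
bundles `E` the latter does not change `[c,φ]` (`BType.commRight_proj`). -/

namespace Twistor

/-! ### Closure properties of smooth maps on the twistor space. -/

section Smoothness

variable {V : Type*} [NormedAddCommGroup V] [InnerProductSpace ℝ V]
variable {W : Type*} [NormedAddCommGroup W] [NormedSpace ℝ W]
variable {W' : Type*} [NormedAddCommGroup W'] [NormedSpace ℝ W']

theorem Smooth.add {f g : TwistorSpace V → W} (hf : Smooth f) (hg : Smooth g) :
    Smooth (fun K => f K + g K) := fun K => (hf K).add (hg K)

theorem Smooth.clm_comp (T : W →L[ℝ] W') {f : TwistorSpace V → W} (hf : Smooth f) :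
    Smooth (fun K => T (f K)) := fun K => by
  obtain ⟨U, F, hU, hK, hF, h⟩ := hf K
  exact ⟨U, fun x => T (F x), hU, hK, T.contDiff.comp_contDiffOn hF, fun L hL => by
    simp only [h L hL]⟩

theorem Smooth.neg {f : TwistorSpace V → W} (hf : Smooth f) : Smooth (fun K => -f K) :=
  hf.clm_comp (-ContinuousLinearMap.id ℝ W)

theorem Smooth.sub {f g : TwistorSpace V → W} (hf : Smooth f) (hg : Smooth g) :
    Smooth (fun K => f K - g K) := by
  simpa only [sub_eq_add_neg] using hf.add hg.neg

theorem Smooth.mul {f g : TwistorSpace V → (V →L[ℝ] V)} (hf : Smooth f) (hg : Smooth g) :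
    Smooth (fun K => f K * g K) := fun K => by
  obtain ⟨U, F, hU, hK, hF, h⟩ := hf K
  obtain ⟨U', G, hU', hK', hG, h'⟩ := hg K
  refine ⟨U ∩ U', fun x => F x * G x, hU.inter hU', ⟨hK, hK'⟩,
    (hF.mono Set.inter_subset_left).mul (hG.mono Set.inter_subset_right), fun L hL => ?_⟩
  simp only [h L hL.1, h' L hL.2]

theorem Smooth.coe : Smooth (fun K : TwistorSpace V => (K : V →L[ℝ] V)) := fun _ =>
  ⟨Set.univ, id, isOpen_univ, trivial, contDiffOn_id, fun _ _ => rfl⟩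

theorem Smooth.star [CompleteSpace V] {f : TwistorSpace V → (V →L[ℝ] V)} (hf : Smooth f) :
    Smooth (fun K => star (f K)) :=
  hf.clm_comp (starL' ℝ : (V →L[ℝ] V) ≃L[ℝ] (V →L[ℝ] V)).toContinuousLinearMap

end Smoothness

/-! ### Calculus of tangential derivatives, computed along curves. -/

section Derivatives

variable {V : Type*} [NormedAddCommGroup V] [InnerProductSpace ℝ V] [FiniteDimensional ℝ V]
variable {W : Type*} [NormedAddCommGroup W] [NormedSpace ℝ W]
variable {K : TwistorSpace V} {X : V →L[ℝ] V}

/-- A tangent derivative is computed along any one curve with the given velocity. -/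
theorem exists_curve (hX : X ∈ tangent K) : ∃ c : ℝ → TwistorSpace V, c 0 = K ∧
    HasDerivAt (fun t => (c t : V →L[ℝ] V)) X 0 ∧
    ∀ {W : Type _} [NormedAddCommGroup W] [NormedSpace ℝ W] {f : TwistorSpace V → W},
      Smooth f → HasDerivAt (fun t => f (c t)) (tderiv f K X) 0 := by
  obtain ⟨c, rfl, hc⟩ := (mem_tangent_iff K X).1 hX
  exact ⟨c, rfl, hc, fun hf => hasDerivAt_comp_curve (hf _) hc⟩

/-- Derivatives within the twistor set are not determined in normal directions. In a tangent
direction both sides are the derivative along one curve, so any local extension may be used; this is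
what makes tangential derivatives smooth. -/
theorem tderiv_eq_fderiv (hX : X ∈ tangent K) {f : TwistorSpace V → W} (hf : Smooth f)
    {U : Set (V →L[ℝ] V)} {F : (V →L[ℝ] V) → W} (hU : IsOpen U) (hK : (K : V →L[ℝ] V) ∈ U)
    (hF : ContDiffOn ℝ ∞ F U)
    (h : ∀ L : TwistorSpace V, (L : V →L[ℝ] V) ∈ U → F L = f L) :
    tderiv f K X = fderiv ℝ F K X := by
  obtain ⟨c, rfl, hc, hd⟩ := exists_curve hX
  have h1 : HasFDerivAt F (fderiv ℝ F (c 0)) (c 0 : V →L[ℝ] V) :=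
    ((hF.contDiffAt (hU.mem_nhds hK)).differentiableAt (by simp)).hasFDerivAt
  have h2 := h1.comp_hasDerivAt (f := fun t => (c t : V →L[ℝ] V)) (0 : ℝ) hc
  refine (hd hf).unique (h2.congr_of_eventuallyEq ?_)
  filter_upwards [hc.continuousAt.preimage_mem_nhds (hU.mem_nhds hK)] with t ht
  exact (h (c t) ht).symm

theorem Smooth.tderiv {f : TwistorSpace V → W} (hf : Smooth f)
    {X : TwistorSpace V → (V →L[ℝ] V)} (hX : Smooth X) (hXt : ∀ K, X K ∈ tangent K) :
    Smooth (fun K => tderiv f K (X K)) := fun K => by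
  obtain ⟨U, F, hU, hK, hF, h⟩ := hf K
  obtain ⟨U', G, hU', hK', hG, h'⟩ := hX K
  refine ⟨U ∩ U', fun x => fderiv ℝ F x (G x), hU.inter hU', ⟨hK, hK'⟩,
    ((hF.fderiv_of_isOpen hU (by simp)).mono Set.inter_subset_left).clm_apply
      (hG.mono Set.inter_subset_right), fun L hL => ?_⟩
  simp only [h' L hL.2, tderiv_eq_fderiv (hXt L) hf hU hL.1 hF h]

theorem tderiv_add (hX : X ∈ tangent K) {f g : TwistorSpace V → W} (hf : Smooth f)
    (hg : Smooth g) : tderiv (fun L => f L + g L) K X = tderiv f K X + tderiv g K X := by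
  obtain ⟨c, rfl, hc, hd⟩ := exists_curve hX
  exact (hd (hf.add hg)).unique ((hd hf).add (hd hg))

theorem tderiv_sub (hX : X ∈ tangent K) {f g : TwistorSpace V → W} (hf : Smooth f)
    (hg : Smooth g) : tderiv (fun L => f L - g L) K X = tderiv f K X - tderiv g K X := by
  obtain ⟨c, rfl, hc, hd⟩ := exists_curve hX
  exact (hd (hf.sub hg)).unique ((hd hf).sub (hd hg))

theorem tderiv_smul (hX : X ∈ tangent K) {f : TwistorSpace V → ℝ} {g : TwistorSpace V → W}
    (hf : Smooth f) (hg : Smooth g) :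
    tderiv (fun L => f L • g L) K X = f K • tderiv g K X + tderiv f K X • g K := by
  obtain ⟨c, rfl, hc⟩ := (mem_tangent_iff K X).1 hX
  exact (hasDerivAt_comp_curve ((hf _).smul (hg _)) hc).unique
    ((hasDerivAt_comp_curve (hf _) hc).smul (hasDerivAt_comp_curve (hg _) hc))

theorem tderiv_mul (hX : X ∈ tangent K) {f g : TwistorSpace V → (V →L[ℝ] V)}
    (hf : Smooth f) (hg : Smooth g) :
    tderiv (fun L => f L * g L) K X = tderiv f K X * g K + f K * tderiv g K X := by
  obtain ⟨c, rfl, hc, hd⟩ := exists_curve hX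
  exact (hd (hf.mul hg)).unique ((hd hf).mul (hd hg))

theorem tderiv_const (hX : X ∈ tangent K) (w : W) :
    tderiv (fun _ => w) K X = 0 := by
  obtain ⟨c, rfl, hc, hd⟩ := exists_curve hX
  exact (hd (Smooth.const w)).unique (hasDerivAt_const _ _)

theorem tderiv_coe (hX : X ∈ tangent K) :
    tderiv (fun L : TwistorSpace V => (L : V →L[ℝ] V)) K X = X := by
  obtain ⟨c, rfl, hc, hd⟩ := exists_curve hX
  exact (hd Smooth.coe).unique hc

theorem tderiv_star [CompleteSpace V] (hX : X ∈ tangent K) {f : TwistorSpace V → (V →L[ℝ] V)}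
    (hf : Smooth f) : tderiv (fun L => star (f L)) K X = star (tderiv f K X) := by
  obtain ⟨c, rfl, hc, hd⟩ := exists_curve hX
  exact (hd hf.star).unique (hd hf).star

theorem tderiv_neg (hX : X ∈ tangent K) {f : TwistorSpace V → W} (hf : Smooth f) :
    tderiv (fun L => -f L) K X = -tderiv f K X := by
  obtain ⟨c, rfl, hc, hd⟩ := exists_curve hX
  exact (hd hf.neg).unique (hd hf).neg

end Derivatives

/-! ### Sandwiches `GAG` and their commutators with `φ`. -/

section Algebra

variable {V : Type*} [NormedAddCommGroup V] [InnerProductSpace ℝ V]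

theorem mem_skew_iff_star [CompleteSpace V] {A : V →L[ℝ] V} : A ∈ skew V ↔ star A = -A := by
  constructor
  · intro h
    refine ContinuousLinearMap.ext fun x => ext_inner_right ℝ fun y => ?_
    rw [ContinuousLinearMap.star_eq_adjoint, ContinuousLinearMap.adjoint_inner_left,
      neg_apply, inner_neg_left, h x y, neg_neg]
  · intro h x y
    rw [← ContinuousLinearMap.adjoint_inner_right, ← ContinuousLinearMap.star_eq_adjoint, h,
      neg_apply, inner_neg_right]

theorem star_coe [CompleteSpace V] (K : TwistorSpace V) :
    star (K : V →L[ℝ] V) = -(K : V →L[ℝ] V) :=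
  mem_skew_iff_star.1 (coe_mem_skew K)

theorem Gen.eval_mul_self (J K : TwistorSpace V) (γ : Gen) :
    γ.eval J K * γ.eval J K = -1 := by
  cases γ <;> simp [Gen.eval, coe_mul_self]

theorem Gen.star_eval [CompleteSpace V] (J K : TwistorSpace V) (γ : Gen) :
    star (γ.eval J K) = -γ.eval J K := by
  cases γ <;> simp [Gen.eval, star_coe]

theorem Gen.smooth_eval (J : TwistorSpace V) (γ : Gen) : Smooth (γ.eval J) := by
  cases γ
  · exact Smooth.const _
  · exact Smooth.const _
  · exact Smooth.coe
  · exact Smooth.coe.neg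

theorem SType.smooth_eval (J : TwistorSpace V) (S : SType) : Smooth (S.eval J) := by
  cases S
  · exact Smooth.const _
  · exact (Smooth.const _).add Smooth.coe
  · exact (Smooth.const _).sub Smooth.coe
  · exact ((Smooth.const _).mul Smooth.coe).sub (Smooth.coe.mul (Smooth.const _))

theorem SType.exists_star_eval [CompleteSpace V] (J : TwistorSpace V) (S : SType) :
    ∃ ε : ℝ, ε * ε = 1 ∧ ∀ K, star (S.eval J K) = ε • S.eval J K := by
  cases S
  · exact ⟨1, by norm_num, fun K => by simp [SType.eval]⟩
  · exact ⟨-1, by norm_num, fun K => by simp [SType.eval, star_coe]⟩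
  · exact ⟨-1, by norm_num, fun K => by simp [SType.eval, star_coe, neg_add_eq_sub]⟩
  · exact ⟨-1, by norm_num, fun K => by simp [SType.eval, star_coe]⟩

/-- The sign `ε` appears twice in the adjoint of `GAG`, hence drops out. -/
theorem sandwich_mem_skew [CompleteSpace V] {G A : V →L[ℝ] V} {ε : ℝ} (hε : ε * ε = 1)
    (hG : star G = ε • G) (hA : A ∈ skew V) : G * A * G ∈ skew V := by
  rw [mem_skew_iff_star] at hA ⊢
  rw [star_mul, star_mul, hG, hA]
  simp only [smul_mul_assoc, mul_smul_comm, smul_neg, smul_smul, hε, one_smul, neg_mul, mul_neg,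
    mul_assoc]

/-- Because `K² = -1`, every commutator with `K` anticommutes with `K`. -/
theorem commutator_mem_tangent [CompleteSpace V] (K : TwistorSpace V) {C : V →L[ℝ] V}
    (hC : C ∈ skew V) : C * K - K * C ∈ tangent K := by
  refine ⟨?_, ?_⟩
  · rw [mem_skew_iff_star] at hC ⊢
    simp only [star_sub, star_mul, star_coe, hC]
    simp
  · rw [mul_sub, sub_mul, mul_neg, mul_neg, ← mul_assoc _ (K : V →L[ℝ] V) C, mul_assoc C,
      coe_mul_self]
    simp [mul_assoc]
    abel

/-- `A ↦ A X - X A`. -/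
def commRight (X : V →L[ℝ] V) : (V →L[ℝ] V) →ₗ[ℝ] (V →L[ℝ] V) :=
  LinearMap.mulRight ℝ X - LinearMap.mulLeft ℝ X

theorem commRight_apply (X A : V →L[ℝ] V) : commRight X A = A * X - X * A := rfl

/-- `A ↦ [G A G, K]`. -/
def anchorMap (G K : V →L[ℝ] V) : (V →L[ℝ] V) →ₗ[ℝ] (V →L[ℝ] V) :=
  commRight K ∘ₗ LinearMap.mulRight ℝ G ∘ₗ LinearMap.mulLeft ℝ G

/-- The endomorphism `M` with `dS_{[G A G, φ]} = G M G`. -/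
def SType.corr (S : SType) (J K : TwistorSpace V) : (V →L[ℝ] V) →ₗ[ℝ] (V →L[ℝ] V) :=
  match S with
  | .one => 0
  | .plus => commRight ((SType.plus.tilde .phi).eval J K)
  | .minus => -commRight ((SType.minus.tilde .phi).eval J K)
  | .comm => -(commRight ((SType.comm.tilde .J).eval J K) ∘ₗ
      commRight ((SType.comm.tilde .phi).eval J K))

theorem SType.smooth_corr (S : SType) (J : TwistorSpace V) {A : TwistorSpace V → (V →L[ℝ] V)}
    (hA : Smooth A) : Smooth (fun K => S.corr J K (A K)) := by
  have h : ∀ (γ : Gen) {B : TwistorSpace V → (V →L[ℝ] V)}, Smooth B →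
      Smooth (fun K => commRight (γ.eval J K) (B K)) := fun γ B hB =>
    (hB.mul (γ.smooth_eval J)).sub ((γ.smooth_eval J).mul hB)
  cases S
  · exact Smooth.const 0
  · exact h _ hA
  · exact (h _ hA).neg
  · exact (h _ (h _ hA)).neg

/-- The sections `G` of `𝔤𝔩(𝕍)` that are symmetric or skew and satisfy `γ G = G γ̃` and
`G γ = γ̃ G`. -/
structure IsTwisting [CompleteSpace V] (S : SType) (J : TwistorSpace V)
    (G : TwistorSpace V → (V →L[ℝ] V)) : Prop where
  smooth : Smooth G
  eval_mul : ∀ γ K, γ.eval J K * G K = G K * (S.tilde γ).eval J K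
  mul_eval : ∀ γ K, G K * γ.eval J K = (S.tilde γ).eval J K * G K
  star : ∃ ε : ℝ, ε * ε = 1 ∧ ∀ K, star (G K) = ε • G K

theorem SType.isTwisting_eval [CompleteSpace V] (S : SType) (J : TwistorSpace V) :
    IsTwisting S J (S.eval J) :=
  ⟨S.smooth_eval J, fun γ K => eval_mul_eval J K S γ, fun γ K => eval_mul_eval' J K S γ,
    S.exists_star_eval J⟩

theorem Gen.commute_eval {J K : TwistorSpace V} {Q : V →L[ℝ] V} (hJ : Q * J = J * Q)
    (hK : Q * K = K * Q) (γ : Gen) : Q * γ.eval J K = γ.eval J K * Q := by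
  cases γ <;> simp [Gen.eval, hJ, hK]

theorem SType.commute_eval {J K : TwistorSpace V} {Q : V →L[ℝ] V} (hJ : Q * J = J * Q)
    (hK : Q * K = K * Q) (S : SType) : Q * S.eval J K = S.eval J K * Q := by
  have hJ' : Commute Q (J : V →L[ℝ] V) := hJ
  have hK' : Commute Q (K : V →L[ℝ] V) := hK
  cases S
  · simp [SType.eval]
  · exact (hJ'.add_right hK').eq
  · exact (hJ'.sub_right hK').eq
  · exact ((hJ'.mul_right hK').sub_right (hK'.mul_right hJ')).eq

/-- `Q` is self-adjoint and commutes with `J` and `φ`, hence with `S` and all four generators, so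
`QS` inherits everything from `S`. Treating `S` and `QS` alike lets one formula for `dS` serve for
both. -/
theorem isTwisting_mul [CompleteSpace V] {S : SType} {J : TwistorSpace V}
    {Q : TwistorSpace V → (V →L[ℝ] V)} (hQ : Smooth Q) (hQs : ∀ K, star (Q K) = Q K)
    (hQJ : ∀ K, Q K * J = J * Q K) (hQphi : ∀ K, Q K * K = K * Q K) :
    IsTwisting S J (fun K => Q K * S.eval J K) where
  smooth := hQ.mul (S.smooth_eval J)
  eval_mul γ K := by
    rw [← mul_assoc, ← γ.commute_eval (hQJ K) (hQphi K), mul_assoc, eval_mul_eval, mul_assoc]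
  mul_eval γ K := by
    rw [mul_assoc, eval_mul_eval', ← mul_assoc, Gen.commute_eval (hQJ K) (hQphi K), mul_assoc]
  star := by
    obtain ⟨ε, hε, h⟩ := S.exists_star_eval J
    refine ⟨ε, hε, fun K => ?_⟩
    rw [star_mul, hQs, h, SType.commute_eval (hQJ K) (hQphi K), smul_mul_assoc]

namespace IsTwisting

variable [CompleteSpace V] {S : SType} {J : TwistorSpace V} {G : TwistorSpace V → (V →L[ℝ] V)}
  {A : TwistorSpace V → (V →L[ℝ] V)}

theorem mul_mul_mem_skew (hG : IsTwisting S J G) (K : TwistorSpace V) {A : V →L[ℝ] V}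
    (hA : A ∈ skew V) : G K * A * G K ∈ skew V := by
  obtain ⟨ε, hε, h⟩ := hG.star
  exact sandwich_mem_skew hε (h K) hA

theorem anchorMap_mem_tangent (hG : IsTwisting S J G) (K : TwistorSpace V) {A : V →L[ℝ] V}
    (hA : A ∈ skew V) : anchorMap (G K) K A ∈ tangent K :=
  commutator_mem_tangent K (hG.mul_mul_mem_skew K hA)

theorem smooth_anchorMap (hG : IsTwisting S J G) (hA : Smooth A) :
    Smooth (fun K => anchorMap (G K) K (A K)) :=
  (((hG.smooth.mul hA).mul hG.smooth).mul Smooth.coe).sub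
    (Smooth.coe.mul ((hG.smooth.mul hA).mul hG.smooth))

/-- A generator moves through either factor `G` at the cost of a tilde, so the commutator moves
inside the sandwich. -/
theorem commRight_sandwich (hG : IsTwisting S J G) (γ : Gen) (K : TwistorSpace V)
    (A : V →L[ℝ] V) : commRight (γ.eval J K) (G K * A * G K) =
      G K * commRight ((S.tilde γ).eval J K) A * G K := by
  rw [commRight_apply, commRight_apply, mul_assoc _ (G K), hG.mul_eval γ, ← mul_assoc (γ.eval J K),
    ← mul_assoc (γ.eval J K), hG.eval_mul γ]
  simp only [mul_sub, sub_mul, mul_assoc]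

/-- Up to sign, `dS_X` is `0`, `X` or `[X,J]`, and `X = [GAG,φ]` is itself a sandwich. The middle
factor does not depend on `G`; the cancellation in `leftFactor_identity` uses it for `G = S` and `G
= F` at once. -/
theorem tderiv_eval [FiniteDimensional ℝ V] (hG : IsTwisting S J G) (K : TwistorSpace V)
    {A : V →L[ℝ] V} (hA : A ∈ skew V) :
    tderiv (S.eval J) K (anchorMap (G K) K A) = G K * S.corr J K A * G K := by
  have hX := hG.anchorMap_mem_tangent K hA
  have hX' : anchorMap (G K) K A = G K * commRight ((S.tilde .phi).eval J K) A * G K :=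
    hG.commRight_sandwich .phi K A
  cases S
  · exact (tderiv_const hX (1 : V →L[ℝ] V)).trans (by simp [SType.corr])
  · have h := tderiv_add hX (Smooth.const (J : V →L[ℝ] V)) Smooth.coe
    rw [tderiv_const hX, tderiv_coe hX, zero_add, hX'] at h
    rw [hX']
    exact h
  · have h := tderiv_sub hX (Smooth.const (J : V →L[ℝ] V)) Smooth.coe
    rw [tderiv_const hX, tderiv_coe hX, zero_sub, hX'] at h
    rw [hX']
    refine h.trans ?_
    simp [SType.corr]
  · have h := tderiv_sub hX ((Smooth.const (J : V →L[ℝ] V)).mul Smooth.coe)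
      (Smooth.coe.mul (Smooth.const (J : V →L[ℝ] V)))
    rw [tderiv_mul hX (Smooth.const _) Smooth.coe, tderiv_mul hX Smooth.coe (Smooth.const _),
      tderiv_const hX, tderiv_coe hX] at h
    refine h.trans ?_
    -- Here `dS_X = [J,X] = -[X,J]`, so the commutator is moved inside a second time, now for `J`.
    have h2 := hG.commRight_sandwich .J K (commRight ((SType.comm.tilde .phi).eval J K) A)
    rw [← hX', commRight_apply] at h2
    change _ * (J : V →L[ℝ] V) - J * _ = _ at h2
    simp only [SType.corr, LinearMap.comp_apply, mul_neg, neg_mul, LinearMap.neg_apply]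
    rw [← h2]
    simp

end IsTwisting

end Algebra

/-! ### Smooth local frames. -/

section Subbundle

variable {V : Type*} [NormedAddCommGroup V] [InnerProductSpace ℝ V] [FiniteDimensional ℝ V]

/-- A basis of the fibre at `K` is transported to nearby `L` by `A ↦ TAT` with `T = T K L`.
Invertibility of `T` persists near `K` and makes this map an isomorphism of fibres. -/
theorem isSubbundle_of_sandwich (E : TwistorSpace V → Submodule ℝ (V →L[ℝ] V))
    (T : TwistorSpace V → TwistorSpace V → (V →L[ℝ] V)) (hT : ∀ K, Smooth (T K))
    (hu : ∀ K, IsUnit (T K K))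
    (hmem : ∀ K L A, IsUnit (T K L) → (T K L * A * T K L ∈ E L ↔ A ∈ E K)) : IsSubbundle E := by
  have : CompleteSpace V := FiniteDimensional.complete ℝ V
  intro K
  obtain ⟨U, F, hU, hK, hF, h⟩ := hT K K
  let b := Module.finBasis ℝ (E K)
  have hcont : ContinuousOn (fun L : TwistorSpace V => F L) (Subtype.val ⁻¹' U) :=
    hF.continuousOn.comp continuous_subtype_val.continuousOn fun _ hL => hL
  refine ⟨Subtype.val ⁻¹' U ∩ (fun L : TwistorSpace V => F L) ⁻¹' {x | IsUnit x},
    _, fun i L => T K L * (b i : V →L[ℝ] V) * T K L,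
    hcont.isOpen_inter_preimage (hU.preimage continuous_subtype_val) Units.isOpen, ⟨hK, ?_⟩,
    fun i L _ => ((hT K).mul (Smooth.const _)).mul (hT K) L, ?_⟩
  · simpa [h K hK] using hu K
  · rintro L ⟨hL, hL'⟩
    have hunit : IsUnit (T K L) := by simpa [h L hL] using hL'
    obtain ⟨u, hu⟩ := hunit
    let Φ : (V →L[ℝ] V) →ₗ[ℝ] (V →L[ℝ] V) :=
      LinearMap.mulRight ℝ (T K L) ∘ₗ LinearMap.mulLeft ℝ (T K L)
    have hΦ : ∀ A, Φ A = T K L * A * T K L := fun A => rfl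
    have hinj : Function.Injective Φ := fun A B hAB => by
      rw [hΦ, hΦ, ← hu] at hAB
      simpa using hAB
    have hli := (b.linearIndependent.map' (E K).subtype (Submodule.ker_subtype _)).map' Φ
      (LinearMap.ker_eq_bot.2 hinj)
    refine ⟨hli, ?_⟩
    have hrange : (Set.range fun i => T K L * (b i : V →L[ℝ] V) * T K L) =
        Φ '' ((E K).subtype '' Set.range b) := by
      rw [← Set.range_comp, ← Set.range_comp]; rfl
    rw [hrange, Submodule.span_image, Submodule.span_image, b.span_eq, Submodule.map_subtype_top]
    ext B
    rw [Submodule.mem_map]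
    constructor
    · rintro ⟨A, hA, rfl⟩
      exact (hmem K L A ⟨u, hu⟩).2 hA
    · intro hB
      have hB' : T K L * (↑u⁻¹ * B * ↑u⁻¹) * T K L = B := by
        rw [← hu]; simp [mul_assoc]
      exact ⟨↑u⁻¹ * B * ↑u⁻¹, (hmem K L _ ⟨u, hu⟩).1 (by rwa [hB']), hB'⟩

theorem isSubbundle_skew : IsSubbundle (fun _ : TwistorSpace V => skew V) :=
  isSubbundle_of_sandwich _ (fun _ _ => 1) (fun _ => Smooth.const 1) (fun _ => isUnit_one)
    fun _ _ _ _ => by simp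

/-- With `g`, `l` the values of `γ` at `K`, `L`, the sum `g + l` intertwines them because both
square to `-1`. It is skew, and at `L = K` it is the invertible `2g`. As `δ = sγ`, it intertwines
the values of `δ` as well. -/
theorem isSubbundle_skewRel (J : TwistorSpace V) (γ δ : Gen) (s : ℝ)
    (hδ : ∀ K, δ.eval J K = s • γ.eval J K) :
    IsSubbundle (fun K => skewRel (γ.eval J K) (δ.eval J K)) := by
  have : CompleteSpace V := FiniteDimensional.complete ℝ V
  refine isSubbundle_of_sandwich _ (fun K L => γ.eval J K + γ.eval J L)
    (fun K => (Smooth.const _).add (γ.smooth_eval J)) (fun K => ?_) fun K L A hu => ?_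
  · have h := γ.eval_mul_self J K
    have hg : IsUnit (γ.eval J K) := 
      ⟨⟨γ.eval J K, -γ.eval J K, by simp [h], by simp [h]⟩, rfl⟩
    rw [← two_smul ℝ, Algebra.smul_def]
    exact ((IsUnit.mk0 (2 : ℝ) two_ne_zero).map (algebraMap ℝ (V →L[ℝ] V))).mul hg
  · set g := γ.eval J K
    set l := γ.eval J L
    have hg : g * g = -1 := γ.eval_mul_self J K
    have hl : l * l = -1 := γ.eval_mul_self J L
    have h1 : l * (g + l) = (g + l) * g := by rw [mul_add, add_mul, hg, hl, add_comm]
    have h2 : (g + l) * l = g * (g + l) := by rw [mul_add, add_mul, hg, hl, add_comm]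
    have hs : star (g + l) = -(g + l) := by
      rw [star_add, Gen.star_eval, Gen.star_eval, neg_add]
    have hc : ∀ B C : V →L[ℝ] V, (g + l) * B * (g + l) = (g + l) * C * (g + l) ↔ B = C :=
      fun B C => by rw [hu.mul_left_inj, hu.mul_right_inj]
    refine and_congr ?_ ?_
    · rw [mem_skew_iff_star, mem_skew_iff_star, star_mul, star_mul, hs, ← hc (star A)]
      simp only [neg_mul, mul_neg, neg_neg, mul_assoc]
    · rw [hδ, hδ, ← hc (g * A)]
      have e1 : l * ((g + l) * A * (g + l)) = (g + l) * (g * A) * (g + l) := by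
        rw [← mul_assoc, ← mul_assoc, h1, mul_assoc (g + l) g A]
      have e2 : (g + l) * A * (g + l) * (s • l) = (g + l) * (A * (s • g)) * (g + l) := by
        rw [mul_smul_comm, mul_assoc, h2, mul_smul_comm, mul_smul_comm, smul_mul_assoc]
        simp only [mul_assoc]
      rw [e1, e2]

end Subbundle

/-! ### The factorization of `dF` and the unprojected bracket. -/

section Bracket

variable {V : Type*} [NormedAddCommGroup V] [InnerProductSpace ℝ V]

/-- The Lie bracket of the vector fields `[a, φ]` and `[b, φ]`. -/
theorem lieBracket_commRight [FiniteDimensional ℝ V] [CompleteSpace V]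
    {a b : TwistorSpace V → (V →L[ℝ] V)} (ha : Smooth a)
    (hb : Smooth b) (K : TwistorSpace V) (has : a K ∈ skew V) (hbs : b K ∈ skew V) :
    lieBracket (fun L => commRight L (a L)) (fun L => commRight L (b L)) K =
      commRight K (tderiv b K (commRight K (a K)) - tderiv a K (commRight K (b K)) -
        (a K * b K - b K * a K)) := by
  have hX : commRight K (a K) ∈ tangent K := commutator_mem_tangent K has
  have hY : commRight K (b K) ∈ tangent K := commutator_mem_tangent K hbs
  have key : ∀ {f : TwistorSpace V → (V →L[ℝ] V)} {X : V →L[ℝ] V}, Smooth f → X ∈ tangent K →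
      tderiv (fun L => commRight L (f L)) K X =
        commRight K (tderiv f K X) + (f K * X - X * f K) := fun {f X} hf hX => by
    simp only [commRight_apply]
    rw [tderiv_sub hX (hf.mul Smooth.coe) (Smooth.coe.mul hf), tderiv_mul hX hf Smooth.coe,
      tderiv_mul hX Smooth.coe hf, tderiv_coe hX]
    abel
  -- By Jacobi the leftover `[b,[a,φ]] - [a,[b,φ]]` equals `-[[a,b],φ]`.
  rw [lieBracket, key hb hX, key ha hY, map_sub, map_sub]
  simp only [commRight_apply, mul_sub, sub_mul, mul_assoc]
  abel

theorem tderiv_mem_skew [FiniteDimensional ℝ V] [CompleteSpace V]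
    {B : TwistorSpace V → (V →L[ℝ] V)} (hB : Smooth B)
    (hBs : ∀ K, B K ∈ skew V) {K : TwistorSpace V} {X : V →L[ℝ] V} (hX : X ∈ tangent K) :
    tderiv B K X ∈ skew V := by
  rw [mem_skew_iff_star, ← tderiv_star hX hB, ← tderiv_neg hX hB]
  congr 1
  exact funext fun L => mem_skew_iff_star.1 (hBs L)

/-- The endomorphism `Λ` with `dF_{[F A F, φ]} = F Λ`. -/
noncomputable def leftFactor (S : SType) (J : TwistorSpace V)
    (Q F : TwistorSpace V → (V →L[ℝ] V)) (K : TwistorSpace V) :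
    (V →L[ℝ] V) →ₗ[ℝ] (V →L[ℝ] V) :=
  LinearMap.mulRight ℝ (Q K) ∘ₗ
      (fderivWithin ℝ (Function.extend Subtype.val Q 0) (twistorSet V) K).toLinearMap ∘ₗ
        anchorMap (S.eval J K) K +
    LinearMap.mulRight ℝ (F K * Q K) ∘ₗ S.corr J K

theorem leftFactor_apply (S : SType) (J : TwistorSpace V) (Q F : TwistorSpace V → (V →L[ℝ] V))
    (K : TwistorSpace V) (A : V →L[ℝ] V) : leftFactor S J Q F K A =
      tderiv Q K (anchorMap (S.eval J K) K A) * Q K + S.corr J K A * (F K * Q K) := rfl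

/-- The hypothesis is `QS = SQ` differentiated along `[SAS,φ]`, with `D` the derivative of `Q` and
`sMs` that of `S`. It lets `s` pass to the left of `D`; the error term containing `q` on the left
cancels against the contribution of `dS`, and `qs` factors out on the left. -/
theorem leftFactor_identity {R : Type*} [Ring R] {q s D M : R} (hqs : q * s = s * q)
    (hD : D * s + q * (s * M * s) = s * M * s * q + s * D) :
    q * D * q * s + q * (q * s * M * (q * s)) = q * s * (D * q + M * (q * s * q)) := by
  have h1 : ∀ x, q * (s * x) = s * (q * x) := fun x => by rw [← mul_assoc, hqs, mul_assoc]
  have h2 : ∀ x, D * (s * x) = s * (M * (s * (q * x))) + s * (D * x) -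
      s * (q * (M * (s * x))) := fun x => by
    have := congrArg (· * x) (eq_sub_of_add_eq hD)
    simp only [add_mul, sub_mul, mul_assoc] at this
    rw [this, h1]
  simp only [mul_assoc, mul_add, hqs, h1, h2, mul_sub]
  abel

theorem tderiv_eq_mul_leftFactor [FiniteDimensional ℝ V] [CompleteSpace V]
    {S : SType} {J : TwistorSpace V}
    {Q F : TwistorSpace V → (V →L[ℝ] V)} (hF : ∀ K, F K = Q K * S.eval J K) (hQ : Smooth Q)
    (hQJ : ∀ K, Q K * J = J * Q K) (hQphi : ∀ K, Q K * K = K * Q K) (hFt : IsTwisting S J F)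
    {K : TwistorSpace V} {A : V →L[ℝ] V} (hA : A ∈ skew V)
    (hd : tderiv Q K (anchorMap (F K) K A) =
      Q K * tderiv Q K (anchorMap (S.eval J K) K A) * Q K) :
    tderiv F K (anchorMap (F K) K A) = F K * leftFactor S J Q F K A := by
  have hS := S.isTwisting_eval J
  have hX := hFt.anchorMap_mem_tangent K hA
  have hX' := hS.anchorMap_mem_tangent K hA
  have hcomm : (fun L => Q L * S.eval J L) = fun L => S.eval J L * Q L :=
    funext fun L => S.commute_eval (hQJ L) (hQphi L)
  -- The product is differentiated along `[SAS,φ]` in both orders, and along `[FAF,φ]` in the given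
  -- order.
  have h1 := tderiv_mul hX' hQ hS.smooth
  rw [hcomm, tderiv_mul hX' hS.smooth hQ, hS.tderiv_eval K hA] at h1
  have h2 := tderiv_mul hX hQ hS.smooth
  rw [hFt.tderiv_eval K hA, hd, ← funext hF] at h2
  rw [h2, leftFactor_apply, hF K]
  exact leftFactor_identity (S.commute_eval (hQJ K) (hQphi K)) h1.symm

/-- Taking adjoints in `dF_X = FΛ` gives `ε dF_X = ε Λ*F`, and `ε² = 1`. -/
theorem IsTwisting.tderiv_eq_star_mul [FiniteDimensional ℝ V] [CompleteSpace V]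
    {S : SType} {J : TwistorSpace V}
    {F : TwistorSpace V → (V →L[ℝ] V)} (hF : IsTwisting S J F) {K : TwistorSpace V}
    {X Λ : V →L[ℝ] V} (hX : X ∈ tangent K) (h : tderiv F K X = F K * Λ) :
    tderiv F K X = Star.star Λ * F K := by
  obtain ⟨ε, hε, hs⟩ := hF.star
  have h1 := tderiv_star hX hF.smooth
  rw [funext hs, tderiv_smul hX (Smooth.const ε) hF.smooth, tderiv_const hX, zero_smul, add_zero,
    h, star_mul, hs, mul_smul_comm, ← h] at h1
  have h2 := congrArg (ε • ·) h1
  simpa [smul_smul, hε] using h2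

/-- The bracket of `A` and `B` is the projection to the bundle of
`halfBracket A B - halfBracket B A`. -/
noncomputable def halfBracket [CompleteSpace V] (S : SType) (J : TwistorSpace V)
    (Q F A B : TwistorSpace V → (V →L[ℝ] V)) (K : TwistorSpace V) : V →L[ℝ] V :=
  tderiv B K (anchorMap (F K) K (A K)) + leftFactor S J Q F K (A K) * B K +
    B K * star (leftFactor S J Q F K (A K)) - A K * (F K * F K) * B K

section

variable {S : SType} {J : TwistorSpace V} {Q F A A' B B' : TwistorSpace V → (V →L[ℝ] V)}

theorem smooth_halfBracket [FiniteDimensional ℝ V] [CompleteSpace V]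
    (hQ : Smooth Q) (hF : IsTwisting S J F) (hA : Smooth A)
    (hAs : ∀ K, A K ∈ skew V) (hB : Smooth B) : Smooth (halfBracket S J Q F A B) := by
  have hS := S.isTwisting_eval J
  have hΛ : Smooth (fun K => leftFactor S J Q F K (A K)) :=
    ((hQ.tderiv (hS.smooth_anchorMap hA) fun K => hS.anchorMap_mem_tangent K (hAs K)).mul hQ).add
      ((S.smooth_corr J hA).mul (hF.smooth.mul hQ))
  exact (((hB.tderiv (hF.smooth_anchorMap hA) fun K => hF.anchorMap_mem_tangent K (hAs K)).add
    (hΛ.mul hB)).add (hB.mul hΛ.star)).sub ((hA.mul (hF.smooth.mul hF.smooth)).mul hB)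

theorem halfBracket_add_left [CompleteSpace V] (K : TwistorSpace V) :
    halfBracket S J Q F (A + A') B K =
      halfBracket S J Q F A B K + halfBracket S J Q F A' B K := by
  simp only [halfBracket, Pi.add_apply, map_add, star_add, add_mul, mul_add, tderiv]
  abel

/-- `A` enters only through its value at `K`, linearly: it is never differentiated. -/
theorem halfBracket_smul_left [CompleteSpace V] (f : TwistorSpace V → ℝ) (K : TwistorSpace V) :
    halfBracket S J Q F (fun L => f L • A L) B K = f K • halfBracket S J Q F A B K := by
  simp only [halfBracket, map_smul, star_smul, smul_mul_assoc, mul_smul_comm, tderiv, smul_add,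
    smul_sub, star_trivial]

theorem halfBracket_add_right [FiniteDimensional ℝ V] [CompleteSpace V]
    (hF : IsTwisting S J F) (hB : Smooth B) (hB' : Smooth B')
    (K : TwistorSpace V) (hA : A K ∈ skew V) :
    halfBracket S J Q F A (B + B') K =
      halfBracket S J Q F A B K + halfBracket S J Q F A B' K := by
  have h := tderiv_add (hF.anchorMap_mem_tangent K hA) hB hB'
  change tderiv (B + B') _ _ = _ at h
  simp only [halfBracket, h, Pi.add_apply, add_mul, mul_add]
  abel

theorem halfBracket_smul_right [FiniteDimensional ℝ V] [CompleteSpace V]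
    (hF : IsTwisting S J F) (hB : Smooth B) {f : TwistorSpace V → ℝ}
    (hf : Smooth f) (K : TwistorSpace V) (hA : A K ∈ skew V) :
    halfBracket S J Q F A (fun L => f L • B L) K =
      f K • halfBracket S J Q F A B K + tderiv f K (anchorMap (F K) K (A K)) • B K := by
  simp only [halfBracket, tderiv_smul (hF.anchorMap_mem_tangent K hA) hf hB, smul_mul_assoc,
    mul_smul_comm, smul_add, smul_sub]
  abel

/-- `dB` and `ΛB + BΛ*` are skew when `B` is. As `F²` is symmetric, the adjoint of `A F² B` is `B F²
A`, so the remaining terms become skew on antisymmetrizing. -/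
theorem halfBracket_sub_mem_skew [FiniteDimensional ℝ V] [CompleteSpace V]
    (hF : IsTwisting S J F) (hA : Smooth A)
    (hAs : ∀ K, A K ∈ skew V) (hB : Smooth B) (hBs : ∀ K, B K ∈ skew V) (K : TwistorSpace V) :
    halfBracket S J Q F A B K - halfBracket S J Q F B A K ∈ skew V := by
  have h1 := mem_skew_iff_star.1 (tderiv_mem_skew hB hBs (hF.anchorMap_mem_tangent K (hAs K)))
  have h2 := mem_skew_iff_star.1 (tderiv_mem_skew hA hAs (hF.anchorMap_mem_tangent K (hBs K)))
  have h3 := mem_skew_iff_star.1 (hAs K)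
  have h4 := mem_skew_iff_star.1 (hBs K)
  have h5 : star (F K * F K) = F K * F K := by
    obtain ⟨ε, hε, h⟩ := hF.star
    rw [star_mul, h, smul_mul_smul_comm, hε, one_smul]
  rw [mem_skew_iff_star]
  simp only [halfBracket, star_sub, star_add, star_mul, star_star, h1, h2, h3, h4] at h5 ⊢
  simp only [h5, mul_neg, neg_mul, mul_assoc]
  abel

theorem mul_halfBracket_mul [FiniteDimensional ℝ V] [CompleteSpace V]
    (hF : IsTwisting S J F) (hB : Smooth B) {K : TwistorSpace V}
    (hA : A K ∈ skew V)
    (hd : tderiv F K (anchorMap (F K) K (A K)) = F K * leftFactor S J Q F K (A K)) :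
    F K * halfBracket S J Q F A B K * F K =
      tderiv (fun L => F L * B L * F L) K (anchorMap (F K) K (A K)) -
        (F K * A K * F K) * (F K * B K * F K) := by
  have hX := hF.anchorMap_mem_tangent K hA
  have hd' := hF.tderiv_eq_star_mul hX hd
  rw [tderiv_mul hX (hF.smooth.mul hB) hF.smooth, tderiv_mul hX hF.smooth hB]
  -- The right-hand `dF` is written as `Λ*F` and the left-hand one as `FΛ`, leaving `F` on both
  -- outer sides.
  nth_rewrite 2 [hd']
  rw [hd]
  simp only [halfBracket, mul_add, add_mul, mul_sub, sub_mul, mul_assoc]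
  abel

theorem mul_halfBracket_sub_mul [FiniteDimensional ℝ V] [CompleteSpace V]
    (hF : IsTwisting S J F) (hA : Smooth A) (hB : Smooth B)
    {K : TwistorSpace V} (hAs : A K ∈ skew V) (hBs : B K ∈ skew V)
    (hdA : tderiv F K (anchorMap (F K) K (A K)) = F K * leftFactor S J Q F K (A K))
    (hdB : tderiv F K (anchorMap (F K) K (B K)) = F K * leftFactor S J Q F K (B K)) :
    F K * (halfBracket S J Q F A B K - halfBracket S J Q F B A K) * F K =
      tderiv (fun L => F L * B L * F L) K (commRight K (F K * A K * F K)) -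
        tderiv (fun L => F L * A L * F L) K (commRight K (F K * B K * F K)) -
        ((F K * A K * F K) * (F K * B K * F K) - (F K * B K * F K) * (F K * A K * F K)) := by
  rw [mul_sub, sub_mul, mul_halfBracket_mul hF hB hAs hdA, mul_halfBracket_mul hF hA hBs hdB]
  change _ = tderiv _ K (anchorMap (F K) K (A K)) - tderiv _ K (anchorMap (F K) K (B K)) - _
  abel

end

/-! ### Projection to the bundles, and the projected bracket. -/

/-- The projection `C ↦ (C - γ C δ) / 2` to `{A | γ A = A δ}`. -/
noncomputable def BType.proj (J K : TwistorSpace V) : BType → (V →L[ℝ] V) →ₗ[ℝ] (V →L[ℝ] V)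
  | .all => LinearMap.id
  | .rel γ δ => (2⁻¹ : ℝ) • (LinearMap.id -
      LinearMap.mulRight ℝ (δ.eval J K) ∘ₗ LinearMap.mulLeft ℝ (γ.eval J K))

theorem BType.proj_rel_apply (J K : TwistorSpace V) (γ δ : Gen) (C : V →L[ℝ] V) :
    (BType.rel γ δ).proj J K C = (2⁻¹ : ℝ) • (C - γ.eval J K * C * δ.eval J K) := rfl

/-- In every bundle `{A | γ A = A δ}` considered, `δ = ± γ`. -/
def BType.IsSigned (J : TwistorSpace V) : BType → Prop
  | .all => True
  | .rel γ δ => ∃ s : ℝ, ∀ K, δ.eval J K = s • γ.eval J K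

theorem BType.isSigned_twist (J : TwistorSpace V) (S : SType) {E : BType}
    (hE : E = BType.all ∨ E = BType.oPhi ∨ E = BType.uJ ∨ E = BType.uPhi) :
    (E.twist S).IsSigned J := by
  rcases hE with rfl | rfl | rfl | rfl
  · trivial
  · refine ⟨-1, fun K => ?_⟩
    cases S <;> simp [SType.tilde, Gen.eval]
  · exact ⟨1, fun K => (one_smul _ _).symm⟩
  · exact ⟨1, fun K => (one_smul _ _).symm⟩

theorem BType.fiber_le_skew (T : BType) (J K : TwistorSpace V) : T.fiber J K ≤ skew V := by
  cases T
  · exact le_rfl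
  · exact fun A hA => hA.1

theorem BType.isSubbundle_fiber [FiniteDimensional ℝ V]
    {T : BType} {J : TwistorSpace V} (hT : T.IsSigned J) :
    IsSubbundle (T.fiber J) := by
  cases T
  · exact isSubbundle_skew
  · obtain ⟨s, hs⟩ := hT
    exact isSubbundle_skewRel J _ _ s hs

theorem BType.smooth_proj (T : BType) (J : TwistorSpace V) {C : TwistorSpace V → (V →L[ℝ] V)}
    (hC : Smooth C) : Smooth (fun K => T.proj J K (C K)) := by
  cases T with
  | all => exact hC
  | rel γ δ =>
    exact fun K => (Smooth.const (2⁻¹ : ℝ) K).smul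
      ((hC.sub (((γ.smooth_eval J).mul hC).mul (δ.smooth_eval J))) K)

/-- The relation holds because `γ² = δ² = -1`. Preservation of skewness needs `δ` to be a multiple
of `γ`, since the adjoint interchanges the two. -/
theorem BType.proj_mem [CompleteSpace V] {T : BType} {J : TwistorSpace V} (hT : T.IsSigned J)
    (K : TwistorSpace V) {C : V →L[ℝ] V} (hC : C ∈ skew V) : T.proj J K C ∈ T.fiber J K := by
  cases T with
  | all => exact hC
  | rel γ δ =>
    obtain ⟨s, hs⟩ := hT
    rw [proj_rel_apply]
    refine Submodule.smul_mem _ _ ⟨?_, ?_⟩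
    · rw [mem_skew_iff_star] at hC ⊢
      simp only [hs, star_sub, star_mul, star_smul, Gen.star_eval, hC, star_trivial]
      simp [mul_assoc]
      abel
    · have h1 := γ.eval_mul_self J K
      have h2 := δ.eval_mul_self J K
      rw [mul_sub, sub_mul, ← mul_assoc, ← mul_assoc, h1, mul_assoc _ (δ.eval J K), h2]
      simp
      abel

theorem BType.proj_eq_self (T : BType) (J K : TwistorSpace V) {C : V →L[ℝ] V}
    (hC : C ∈ T.fiber J K) : T.proj J K C = C := by
  cases T with
  | all => rfl
  | rel γ δ =>
    rw [proj_rel_apply, hC.2, mul_assoc, δ.eval_mul_self J K, mul_neg, mul_one, sub_neg_eq_add,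
      ← two_smul ℝ, smul_smul, inv_mul_cancel₀ two_ne_zero, one_smul]

/-- The outer factors `F` absorb the tildes: `F γ̃ C δ̃ F = γ F C F δ`. -/
theorem IsTwisting.mul_proj_mul [CompleteSpace V] {S : SType} {J : TwistorSpace V}
    {F : TwistorSpace V → (V →L[ℝ] V)} (hF : IsTwisting S J F) (E : BType) (K : TwistorSpace V)
    (C : V →L[ℝ] V) :
    F K * (E.twist S).proj J K C * F K = E.proj J K (F K * C * F K) := by
  cases E with
  | all => rfl
  | rel γ δ =>
    rw [BType.twist, BType.proj_rel_apply, BType.proj_rel_apply, mul_smul_comm, smul_mul_assoc,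
      mul_sub, sub_mul, ← mul_assoc (γ.eval J K), ← mul_assoc (γ.eval J K), hF.eval_mul γ,
      mul_assoc _ (F K) (δ.eval J K), hF.mul_eval δ]
    simp only [mul_assoc]

theorem IsTwisting.mul_mul_mem_fiber [CompleteSpace V] {S : SType} {J : TwistorSpace V}
    {F : TwistorSpace V → (V →L[ℝ] V)} (hF : IsTwisting S J F) {E : BType} {K : TwistorSpace V}
    {A : V →L[ℝ] V} (hA : A ∈ (E.twist S).fiber J K) : F K * A * F K ∈ E.fiber J K := by
  cases E with
  | all => exact hF.mul_mul_mem_skew K hA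
  | rel γ δ =>
    refine ⟨hF.mul_mul_mem_skew K hA.1, ?_⟩
    rw [← mul_assoc, ← mul_assoc, hF.eval_mul γ, mul_assoc _ (F K) (δ.eval J K), hF.mul_eval δ,
      mul_assoc (F K) _ A, hA.2]
    simp only [mul_assoc]

/-- Projecting to the fibre of `E` does not change the vector field of a bracket. -/
theorem BType.commRight_proj [FiniteDimensional ℝ V] [CompleteSpace V]
    {E : BType} {J : TwistorSpace V}
    (hE : E = BType.all ∨ E = BType.oPhi ∨ E = BType.uJ ∨ E = BType.uPhi)
    {a b : TwistorSpace V → (V →L[ℝ] V)} (ha : Smooth a) (hb : Smooth b)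
    (haE : ∀ K, a K ∈ E.fiber J K) (hbE : ∀ K, b K ∈ E.fiber J K) (K : TwistorSpace V)
    {c : V →L[ℝ] V} (hc : c = tderiv b K (commRight K (a K)) - tderiv a K (commRight K (b K)) -
      (a K * b K - b K * a K)) :
    commRight K (E.proj J K c) = commRight K c := by
  have hcomm : ∀ {γ : Gen} {C : V →L[ℝ] V}, Commute (γ.eval J K) C →
      (BType.rel γ γ).proj J K C = C := fun {γ C} h => by
    rw [BType.proj_rel_apply, h.eq, mul_assoc, γ.eval_mul_self J K, mul_neg, mul_one,
      sub_neg_eq_add, ← two_smul ℝ, smul_smul, inv_mul_cancel₀ two_ne_zero, one_smul]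
  have hX : commRight K (a K) ∈ tangent K :=
    commutator_mem_tangent K (E.fiber_le_skew J K (haE K))
  have hY : commRight K (b K) ∈ tangent K :=
    commutator_mem_tangent K (E.fiber_le_skew J K (hbE K))
  rcases hE with rfl | rfl | rfl | rfl
  · rfl
  -- The projection is `(c + φcφ)/2`, and `φcφ` has the same commutator with `φ` as `c`.
  · rw [BType.oPhi, proj_rel_apply, map_smul]
    simp only [Gen.eval, commRight_apply, mul_neg, sub_neg_eq_add, add_mul, mul_add]
    rw [mul_assoc _ (K : V →L[ℝ] V) (K : V →L[ℝ] V), ← mul_assoc (K : V →L[ℝ] V) (_ * _),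
      ← mul_assoc (K : V →L[ℝ] V) (K : V →L[ℝ] V), coe_mul_self]
    simp only [mul_neg, mul_one, neg_mul, one_mul]
    rw [show c * (K : V →L[ℝ] V) + -(K * c) - (K * c + -(c * K)) =
      (2 : ℝ) • (c * K - K * c) by rw [two_smul]; abel, smul_smul,
      inv_mul_cancel₀ two_ne_zero, one_smul]
  -- `J` is constant, so derivatives of sections commuting with `J` commute with `J`; hence so does
  -- `c`, and the projection fixes it.
  · have hJ : ∀ {f : TwistorSpace V → (V →L[ℝ] V)} {X : V →L[ℝ] V}, Smooth f →
        (∀ L, f L ∈ BType.uJ.fiber J L) → X ∈ tangent K →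
        Commute (J : V →L[ℝ] V) (tderiv f K X) := fun {f X} hf hfJ hX => by
      have h1 := tderiv_mul hX (Smooth.const (J : V →L[ℝ] V)) hf
      rw [show (fun L => (J : V →L[ℝ] V) * f L) = fun L => f L * J from
        funext fun L => (hfJ L).2, tderiv_mul hX hf (Smooth.const _), tderiv_const hX] at h1
      simpa [Commute, SemiconjBy] using h1.symm
    have h1 : Commute (J : V →L[ℝ] V) (a K) := (haE K).2
    have h2 : Commute (J : V →L[ℝ] V) (b K) := (hbE K).2
    have h3 : Commute (J : V →L[ℝ] V) c := by
      rw [hc]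
      exact ((hJ hb hbE hX).sub_right (hJ ha haE hY)).sub_right
        ((h1.mul_right h2).sub_right (h2.mul_right h1))
    rw [BType.uJ, hcomm (γ := .J) h3]
  -- Both vector fields vanish, so `c = -[a,b]` commutes with `φ` and is fixed by the projection.
  · have h1 : Commute (K : V →L[ℝ] V) (a K) := (haE K).2
    have h2 : Commute (K : V →L[ℝ] V) (b K) := (hbE K).2
    have h3 : Commute (K : V →L[ℝ] V) c := by
      rw [hc, commRight_apply, commRight_apply, h1.eq, h2.eq, sub_self, sub_self]
      simp only [tderiv, map_zero, sub_self, zero_sub]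
      exact ((h1.mul_right h2).sub_right (h2.mul_right h1)).neg_right
    rw [BType.uPhi, hcomm (γ := .phi) h3]

/-- The bracket `[A, B]_F` on `Γ(T)`. -/
noncomputable def twistedBracket [FiniteDimensional ℝ V] [CompleteSpace V]
    {S : SType} {J : TwistorSpace V}
    {Q F : TwistorSpace V → (V →L[ℝ] V)} {T : BType} (hT : T.IsSigned J) (hQ : Smooth Q)
    (hF : IsTwisting S J F) :
    Sections (T.fiber J) →ₗ[ℝ] Sections (T.fiber J) →ₗ[ℝ] Sections (T.fiber J) :=
  have hs : ∀ (A : Sections (T.fiber J)) K, A.1 K ∈ skew V := fun A K =>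
    T.fiber_le_skew J K (A.2.2 K)
  LinearMap.mk₂ ℝ
    (fun A B => ⟨fun K => T.proj J K
        (halfBracket S J Q F A.1 B.1 K - halfBracket S J Q F B.1 A.1 K),
      T.smooth_proj J ((smooth_halfBracket hQ hF A.2.1 (hs A) B.2.1).sub
        (smooth_halfBracket hQ hF B.2.1 (hs B) A.2.1)),
      fun K => BType.proj_mem hT K
        (halfBracket_sub_mem_skew hF A.2.1 (hs A) B.2.1 (hs B) K)⟩)
    (fun A A' B => Subtype.ext <| funext fun K => by
      simp only [Submodule.coe_add, Pi.add_apply, halfBracket_add_left,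
        halfBracket_add_right hF A.2.1 A'.2.1 K (hs B K)]
      rw [← map_add]
      congr 1
      abel)
    (fun r A B => Subtype.ext <| funext fun K => by
      have h1 := halfBracket_smul_left (S := S) (J := J) (Q := Q) (F := F) (A := A.1)
        (B := B.1) (fun _ => r) K
      have h2 := halfBracket_smul_right (Q := Q) hF A.2.1 (Smooth.const r) K (hs B K)
      rw [tderiv_const (hF.anchorMap_mem_tangent K (hs B K)), zero_smul, add_zero] at h2
      change T.proj J K (halfBracket S J Q F (fun L => r • A.1 L) B.1 K -
        halfBracket S J Q F B.1 (fun L => r • A.1 L) K) = r • T.proj J K _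
      rw [h1, h2, ← smul_sub, map_smul])
    (fun A B B' => Subtype.ext <| funext fun K => by
      simp only [Submodule.coe_add, Pi.add_apply, halfBracket_add_left,
        halfBracket_add_right hF B.2.1 B'.2.1 K (hs A K)]
      rw [← map_add]
      congr 1
      abel)
    (fun r A B => Subtype.ext <| funext fun K => by
      have h1 := halfBracket_smul_left (S := S) (J := J) (Q := Q) (F := F) (A := B.1)
        (B := A.1) (fun _ => r) K
      have h2 := halfBracket_smul_right (Q := Q) hF B.2.1 (Smooth.const r) K (hs A K)
      rw [tderiv_const (hF.anchorMap_mem_tangent K (hs A K)), zero_smul, add_zero] at h2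
      change T.proj J K (halfBracket S J Q F A.1 (fun L => r • B.1 L) K -
        halfBracket S J Q F (fun L => r • B.1 L) A.1 K) = r • T.proj J K _
      rw [h1, h2, ← smul_sub, map_smul])

theorem twistedBracket_apply [FiniteDimensional ℝ V] [CompleteSpace V]
    {S : SType} {J : TwistorSpace V}
    {Q F : TwistorSpace V → (V →L[ℝ] V)} {T : BType} (hT : T.IsSigned J) (hQ : Smooth Q)
    (hF : IsTwisting S J F) (A B : Sections (T.fiber J)) (K : TwistorSpace V) :
    (twistedBracket hT hQ hF A B).1 K = T.proj J K
      (halfBracket S J Q F A.1 B.1 K - halfBracket S J Q F B.1 A.1 K) := rfl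

end Bracket

end Twistor

/-! ### The theorem. -/

open Twistor in
theorem theorem4p1 {V : Type*} [NormedAddCommGroup V] [InnerProductSpace ℝ V]
    [FiniteDimensional ℝ V] (hdim : 4 ≤ Module.finrank ℝ V)
    (J : TwistorSpace V) (S : SType) (E : BType)
    (hE : E = BType.all ∨ E = BType.oPhi ∨ E = BType.uJ ∨ E = BType.uPhi)
    (Q F : TwistorSpace V → (V →L[ℝ] V))
    (hF : ∀ K, F K = Q K * S.eval J K)
    (hQ : Twistor.Smooth Q)
    (hQadj : ∀ K, (Q K : V →ₗ[ℝ] V).IsSymmetric)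
    (hQJ : ∀ K, Q K * J = J * Q K)
    (hQphi : ∀ K, Q K * K = K * Q K)
    (hdQ : ∀ (C : Sections ((E.twist S).fiber J)) (K : TwistorSpace V),
      tderiv Q K (applyAnchor (anchor ((E.twist S).fiber J) F) C K) =
        Q K * tderiv Q K (applyAnchor (anchor ((E.twist S).fiber J) (S.eval J)) C K) * Q K) :
    ∃ br : Sections ((E.twist S).fiber J) →ₗ[ℝ] Sections ((E.twist S).fiber J) →ₗ[ℝ]
        Sections ((E.twist S).fiber J),
      IsSkewAlgebroid ((E.twist S).fiber J) br (anchor ((E.twist S).fiber J) F) := by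
  have : CompleteSpace V := FiniteDimensional.complete ℝ V
  have hQs : ∀ K, star (Q K) = Q K := fun K =>
    (ContinuousLinearMap.isSelfAdjoint_iff_isSymmetric.2 (hQadj K)).star_eq
  have hFt : IsTwisting S J F := by
    rw [funext hF]
    exact isTwisting_mul hQ hQs hQJ hQphi
  have hT := BType.isSigned_twist J S hE
  have hs : ∀ (A : Sections ((E.twist S).fiber J)) K, A.1 K ∈ skew V := fun A K =>
    BType.fiber_le_skew _ J K (A.2.2 K)
  have hd : ∀ (A : Sections ((E.twist S).fiber J)) K,
      tderiv F K (anchorMap (F K) K (A.1 K)) = F K * leftFactor S J Q F K (A.1 K) := fun A K =>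
    tderiv_eq_mul_leftFactor hF hQ hQJ hQphi hFt (hs A K) (hdQ A K)
  have hsm : ∀ A : Sections ((E.twist S).fiber J), Smooth (fun L => F L * A.1 L * F L) :=
    fun A => (hFt.smooth.mul A.2.1).mul hFt.smooth
  have hbracket : ∀ A B, twistedBracket hT hQ hFt A B = -twistedBracket hT hQ hFt B A :=
    fun A B => Subtype.ext <| funext fun K => by
      change _ = -(twistedBracket hT hQ hFt B A).1 K
      rw [twistedBracket_apply, twistedBracket_apply, ← map_neg, neg_sub]
  refine ⟨twistedBracket hT hQ hFt, BType.isSubbundle_fiber hT,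
    fun K a => hFt.anchorMap_mem_tangent K (BType.fiber_le_skew _ J K a.2),
    fun A => hFt.smooth_anchorMap A.2.1, hbracket, fun A B K => ?_, fun A B f hf K => ?_⟩
  · have h1 := lieBracket_commRight (hsm A) (hsm B) K (hFt.mul_mul_mem_skew K (hs A K))
      (hFt.mul_mul_mem_skew K (hs B K))
    refine Eq.trans ?_ h1.symm
    have h2 := mul_halfBracket_sub_mul hFt A.2.1 B.2.1 (hs A K) (hs B K) (hd A K) (hd B K)
    -- The vector field is unchanged on replacing `c = FCF` by its projection to `E`, which is the
    -- sandwich of the projection of `C` to `E^S`.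
    rw [← h2, ← BType.commRight_proj hE (hsm A) (hsm B)
      (fun L => hFt.mul_mul_mem_fiber (A.2.2 L)) (fun L => hFt.mul_mul_mem_fiber (B.2.2 L)) K h2,
      ← hFt.mul_proj_mul]
    rfl
  · rw [twistedBracket_apply, twistedBracket_apply]
    have h1 := halfBracket_smul_right (Q := Q) hFt B.2.1 hf K (hs A K)
    have h2 := halfBracket_smul_left (S := S) (J := J) (Q := Q) (F := F) (A := B.1)
      (B := A.1) f K
    have h3 := BType.proj_eq_self _ J K (B.2.2 K)
    change BType.proj J K _ (halfBracket S J Q F A.1 (fun L => f L • B.1 L) K -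
        halfBracket S J Q F (fun L => f L • B.1 L) A.1 K) = _
    -- Only the derivation term survives besides `f` times the bracket, and the projection fixes
    -- `B`.
    rw [h1, h2, add_sub_right_comm, ← smul_sub, map_add, map_smul, map_smul, h3]
    rfl
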